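/- **Theorem (Weak Tits Alternative).** Definitions. Let $X$ be a metric space. A path in $X$ is a (not necessarily continuous) map $\gamma:[a,b]\to X$, $a\le b$; it is a $(K,c)$-quasi-geodesic if $|s-t|/K-c\le d(\gamma(s),\gamma(t))\le K|s-t|+c$ for all $s,t$, and likewise for maps $\mathbb Z\to X$. A *path system* $\mathcal{PS}$ on $X$ is a collection of $(\mu,\mu)$-quasi-geodesics, for one $\mu\ge 1$, that is closed under passing to subpaths and such that any $x,y\in X$ are joined by a path in $\mathcal{PS}$ from $x$ to $y$. A *weak path system* $(X,\mathcal{PS})$ on a group $G$ is an action of $G$ by isometries on a metric space $X$ preserving a path system $\mathcal{PS}$ on $X$. A subset $A\subseteq X$ is *contracting* if there are a constant $C$ and a map $\pi:X\to A$ such that $d(\pi(x),x)\le C$ for $x\in A$, and such that whenever $d(\pi(x),\pi(y))\ge C$, every path $\delta\in\mathcal{PS}$ from $x$ to $y$ satisfies $d(\delta,\pi(x))\le C$ and $d(\delta,\pi(y))\le C$. A subset $S\subseteq X$ is *Morse* if for all $K\ge1$, $c\ge0$ there is $D$ such that every $(K,c)$-quasi-geodesic with endpoints in $S$ stays within distance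 $D$ of $S$. An element $g\in G$ is *WPD* if for every $x\in X$ the map $n\mapsto g^nx$ is a quasi-geodesic with Morse image, and for all $R\ge0$ and $x\in X$ there is $N$ such that $\{h\in G: d(x,hx)\le R,\ d(hg^Nx,g^Nx)\le R\}$ is finite. An element $g\in G$ of infinite order is *weakly contracting* if it is WPD and some orbit of $\langle g\rangle$ is contained in a $g$-invariant contracting set $A$ on which $\langle g\rangle$ acts coboundedly. Statement. Let $G$ be a finitely generated group equipped with a weak path system $(X,\mathcal{PS})$, and let $g\in G$ be weakly contracting. Then either $G$ is virtually cyclic (it has a cyclic subgroup of finite index), or $G$ contains a free group of rank two. More precisely, if $G$ is not virtually cyclic, then there are $h\in G$ and an integer $N\ge1$ such that $hg^N$ is again weakly contracting and, for all sufficiently large $m$, the elements $g^m$ and $(hg^N)^m$ freely generate a free group of rank two. -/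

import Mathlib

open scoped Pointwise

namespace WeakTits

/-- A `(K, c)`-quasi-isometric embedding between metric spaces. On a closed interval of `ℝ` this is
a `(K, c)`-quasi-geodesic (continuity is not required), on `ℤ` a bi-infinite (discrete) one. -/
def IsQIEmbedding {α X : Type*} [PseudoMetricSpace α] [PseudoMetricSpace X]
    (K c : ℝ) (f : α → X) : Prop :=
  ∀ s t : α, dist s t / K - c ≤ dist (f s) (f t) ∧ dist (f s) (f t) ≤ K * dist s t + c

/-- A (not necessarily continuous) path in `X`: a map from a non-empty compact interval. -/
structure IntervalPath (X : Type*) where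
  left : ℝ
  right : ℝ
  le : left ≤ right
  toFun : Set.Icc left right → X

namespace IntervalPath

variable {X : Type*}

/-- The initial point of a path. -/
def source (γ : IntervalPath X) : X := γ.toFun ⟨γ.left, le_rfl, γ.le⟩

/-- The final point of a path. -/
def target (γ : IntervalPath X) : X := γ.toFun ⟨γ.right, γ.le, le_rfl⟩

/-- The set of points on a path. -/
def image (γ : IntervalPath X) : Set X := Set.range γ.toFun

/-- The subpath obtained by restricting to the subinterval `[s, t]`. -/
def subpath (γ : IntervalPath X) (s t : ℝ) (hs : γ.left ≤ s) (hst : s ≤ t) (ht : t ≤ γ.right) :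
    IntervalPath X where
  left := s
  right := t
  le := hst
  toFun := fun u => γ.toFun ⟨u.1, hs.trans u.2.1, u.2.2.trans ht⟩

/-- The translate of a path by a group element. -/
def translate {G : Type*} [Group G] [MulAction G X] (g : G) (γ : IntervalPath X) :
    IntervalPath X where
  left := γ.left
  right := γ.right
  le := γ.le
  toFun := fun u => g • γ.toFun u

end IntervalPath

/-- A path system on the metric space `X`: a collection of `(μ, μ)`-quasi-geodesics, for a common
`μ`, that is closed under taking subpaths and connects all pairs of points. -/
structure IsPathSystem {X : Type*} [MetricSpace X] (PS : Set (IntervalPath X)) : Prop where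
  quasiGeodesic : ∃ μ : ℝ, 1 ≤ μ ∧ ∀ γ ∈ PS, IsQIEmbedding μ μ γ.toFun
  subpath_mem : ∀ γ ∈ PS, ∀ (s t : ℝ) (hs : γ.left ≤ s) (hst : s ≤ t) (ht : t ≤ γ.right),
    γ.subpath s t hs hst ht ∈ PS
  connects : ∀ x y : X, ∃ γ ∈ PS, γ.source = x ∧ γ.target = y

/-- The isometric action of `G` on `X` together with `PS` is a weak path system on `G`: `PS` is a
path system on `X` that the action preserves. -/
structure IsWeakPathSystem (G : Type*) [Group G] {X : Type*} [MetricSpace X] [MulAction G X]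
    [IsIsometricSMul G X] (PS : Set (IntervalPath X)) : Prop where
  isPathSystem : IsPathSystem PS
  translate_mem : ∀ g : G, ∀ γ ∈ PS, γ.translate g ∈ PS

/-- `A` is `PS`-contracting with constant `C`; `π` is the `PS`-projection on `A`. -/
def IsContractingWith {X : Type*} [MetricSpace X] (PS : Set (IntervalPath X)) (C : ℝ)
    (A : Set X) : Prop :=
  ∃ π : X → X, (∀ x, π x ∈ A) ∧ (∀ x ∈ A, dist (π x) x ≤ C) ∧
    ∀ x y : X, C ≤ dist (π x) (π y) → ∀ δ ∈ PS, δ.source = x → δ.target = y →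
      Metric.infDist (π x) δ.image ≤ C ∧ Metric.infDist (π y) δ.image ≤ C

/-- `A` is `PS`-contracting with some constant. -/
def IsContracting {X : Type*} [MetricSpace X] (PS : Set (IntervalPath X)) (A : Set X) : Prop :=
  ∃ C : ℝ, IsContractingWith PS C A

/-- `S` is Morse: quasi-geodesics with endpoints on `S` stay within a distance from `S` that
depends only on the quasi-geodesic constants. -/
def IsMorse {X : Type*} [MetricSpace X] (S : Set X) : Prop :=
  ∀ K c : ℝ, 1 ≤ K → 0 ≤ c → ∃ D : ℝ, ∀ γ : IntervalPath X, IsQIEmbedding K c γ.toFun →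
    γ.source ∈ S → γ.target ∈ S → ∀ p ∈ γ.image, Metric.infDist p S ≤ D

/-- `g` is WPD: the orbits of `⟨g⟩` are Morse quasi-geodesics, and the action is proper in the
direction of `g`. -/
structure IsWPD {G : Type*} [Group G] (X : Type*) [MetricSpace X] [MulAction G X]
    (g : G) : Prop where
  quasiGeodesic : ∀ x : X, ∃ K c : ℝ, 1 ≤ K ∧ 0 ≤ c ∧ IsQIEmbedding K c (fun n : ℤ => g ^ n • x)
  morse : ∀ x : X, IsMorse (Set.range fun n : ℤ => g ^ n • x)
  finite : ∀ R : ℝ, 0 ≤ R → ∀ x : X, ∃ N : ℕ,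
    {h : G | dist x (h • x) ≤ R ∧ dist (h • g ^ N • x) (g ^ N • x) ≤ R}.Finite

/-- `⟨g⟩` acts coboundedly on `A`: the translates of some bounded subset of `A` cover `A`. -/
def ActsCoboundedly {G : Type*} [Group G] {X : Type*} [MetricSpace X] [MulAction G X]
    (g : G) (A : Set X) : Prop :=
  ∃ B ⊆ A, Bornology.IsBounded B ∧ ∀ a ∈ A, ∃ n : ℤ, ∃ b ∈ B, g ^ n • b = a

/-- `g` is weakly `PS`-contracting: it has infinite order, is WPD, and some orbit of `⟨g⟩` is
contained in a contracting `g`-invariant set on which `g` acts coboundedly. -/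
structure IsWeaklyContracting {G : Type*} [Group G] {X : Type*} [MetricSpace X] [MulAction G X]
    (PS : Set (IntervalPath X)) (g : G) : Prop where
  infinite_order : ¬ IsOfFinOrder g
  wpd : IsWPD X g
  axis : ∃ x₀ : X, ∃ A : Set X, (∀ n : ℤ, g ^ n • x₀ ∈ A) ∧ g • A = A ∧ IsContracting PS A ∧
    ActsCoboundedly g A

/-- A group is virtually cyclic if it has a cyclic subgroup of finite index. -/
def IsVirtuallyCyclic (G : Type*) [Group G] : Prop :=
  ∃ H : Subgroup G, IsCyclic H ∧ H.FiniteIndex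

/-- `a` and `b` freely generate a free group of rank two: the homomorphism from the free group on
two letters that sends the letters to `a` and `b` is injective. -/
def GenerateFreely {G : Type*} [Group G] (a b : G) : Prop :=
  Function.Injective (FreeGroup.lift ![a, b])

end WeakTits

/-! Let `A` be the orbit of a suitable point `o` under the powers of `g`. Weak contraction gives a
coarse projection of the space to `A`, recorded as an integer exponent `φ` (`CoarseAxis`). It is
unique up to bounded error, hence coarsely equivariant, and two translates of `A` with bounded
projections to each other satisfy a Behrstock inequality.

WPD separates the translates `hA`. If `h` conjugates a nonzero power of `g` to a nonzero power of
`g`, then `h` lies in one of finitely many cosets of `⟨g⟩`; if all `h` do so, the group is virtually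
cyclic. Otherwise `hA` has uniformly bounded projection to `A` (`bounded_projection`).

Fix a noncommensurating `h` and put `f = h * g ^ N` with `N` large. The orbit of `f` runs along `f ^
k A` for a length `N`, then jumps by `h` to the next translate. By Behrstock, a point has coordinate
near `0` on `f ^ k A` or near `-N` on `f ^ (k + 1) A` (`exists_dichotomy`), so along the line of
translates its coordinate switches once from `0` to `-N`. The place `κ` of the switch is a coarse
projection to the orbit of `f`. Crossing `n` translates takes length at least `n`, so this orbit is
a quasi-geodesic (`exists_axis`); contracting orbits are Morse. WPD of `f` holds because an element
that nearly fixes two distant orbit points must match a translate of `A` with another one up to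
commensuration (`exists_properAlong`).

Finally `φ` and `κ` serve as ping-pong coordinates: `φ` is bounded wherever `κ` differs from `-1`.
-/

namespace WeakTits

/-! ### Displacement of orbit points -/

section Orbits

variable {G : Type*} [Group G] {X : Type*} [MetricSpace X] [MulAction G X] [IsIsometricSMul G X]

theorem dist_inv_smul (u : G) (x y : X) : dist (u⁻¹ • x) y = dist x (u • y) := by
  rw [← dist_smul u (u⁻¹ • x) y, smul_inv_smul]

theorem dist_zpow_smul_zpow_smul (g : G) (o : X) (n m : ℤ) :
    dist (g ^ n • o) (g ^ m • o) = dist (g ^ (n - m) • o) o := by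
  rw [← dist_smul (g ^ m) (g ^ (n - m) • o) o, smul_smul, ← zpow_add, add_sub_cancel]

theorem dist_pow_smul_le (g : G) (o : X) (n : ℕ) : dist (g ^ n • o) o ≤ n * dist (g • o) o := by
  induction n with
  | zero => simp
  | succ n ih =>
    have h1 : dist (g ^ (n + 1) • o) (g ^ n • o) = dist (g • o) o := by
      rw [pow_succ, mul_smul, dist_smul]
    have := dist_triangle (g ^ (n + 1) • o) (g ^ n • o) o
    push_cast
    linarith

theorem dist_zpow_smul_le (g : G) (o : X) (n : ℤ) :
    dist (g ^ n • o) o ≤ |(n : ℝ)| * dist (g • o) o := by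
  obtain ⟨k, rfl | rfl⟩ := n.eq_nat_or_neg
  · simpa using dist_pow_smul_le g o k
  · rw [zpow_neg, dist_inv_smul, dist_comm]
    simpa using dist_pow_smul_le g o k

theorem dist_zpow_smul_le_of_abs_le (g : G) (o : X) {n m : ℤ} {J : ℤ} (h : |n - m| ≤ J) :
    dist (g ^ n • o) (g ^ m • o) ≤ J * dist (g • o) o := by
  rw [dist_zpow_smul_zpow_smul]
  refine (dist_zpow_smul_le g o _).trans ?_
  have : |((n - m : ℤ) : ℝ)| ≤ J := by exact_mod_cast h
  gcongr

end Orbits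

/-! ### Quasi-geodesics evaluated at real times -/

namespace IntervalPath

variable {X : Type*}

/-- The point of a path at time `t`, where times outside the domain are moved to its ends. -/
noncomputable def ev (γ : IntervalPath X) (t : ℝ) : X := γ.toFun (Set.projIcc γ.left γ.right γ.le t)

theorem ev_left (γ : IntervalPath X) : γ.ev γ.left = γ.source := by
  simp [ev, source]

theorem ev_right (γ : IntervalPath X) : γ.ev γ.right = γ.target := by
  simp [ev, target]

theorem ev_of_mem (γ : IntervalPath X) {t : ℝ} (ht : t ∈ Set.Icc γ.left γ.right) :
    γ.ev t = γ.toFun ⟨t, ht⟩ := by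
  rw [ev, Set.projIcc_of_mem γ.le ht]

theorem ev_mem_image (γ : IntervalPath X) (t : ℝ) : γ.ev t ∈ γ.image := ⟨_, rfl⟩

theorem exists_ev_eq (γ : IntervalPath X) {p : X} (hp : p ∈ γ.image) :
    ∃ t ∈ Set.Icc γ.left γ.right, γ.ev t = p := by
  obtain ⟨t, rfl⟩ := hp
  exact ⟨t, t.2, γ.ev_of_mem t.2⟩

theorem ev_subpath (γ : IntervalPath X) {s t : ℝ} (hs : γ.left ≤ s) (hst : s ≤ t)
    (ht : t ≤ γ.right) {u : ℝ} (hu : u ∈ Set.Icc s t) :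
    (γ.subpath s t hs hst ht).ev u = γ.ev u := by
  rw [ev_of_mem _ (t := u) hu, ev_of_mem _ ⟨hs.trans hu.1, hu.2.trans ht⟩]
  rfl

variable [MetricSpace X] {γ : IntervalPath X} {K c : ℝ}

theorem dist_ev_le (h : IsQIEmbedding K c γ.toFun) {s t : ℝ} (hs : s ∈ Set.Icc γ.left γ.right)
    (ht : t ∈ Set.Icc γ.left γ.right) : dist (γ.ev s) (γ.ev t) ≤ K * |s - t| + c := by
  rw [ev_of_mem _ hs, ev_of_mem _ ht]
  exact (h ⟨s, hs⟩ ⟨t, ht⟩).2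

theorem le_dist_ev (h : IsQIEmbedding K c γ.toFun) {s t : ℝ} (hs : s ∈ Set.Icc γ.left γ.right)
    (ht : t ∈ Set.Icc γ.left γ.right) : |s - t| / K - c ≤ dist (γ.ev s) (γ.ev t) := by
  rw [ev_of_mem _ hs, ev_of_mem _ ht]
  exact (h ⟨s, hs⟩ ⟨t, ht⟩).1

theorem abs_sub_le (hK : 1 ≤ K) (h : IsQIEmbedding K c γ.toFun) {s t : ℝ}
    (hs : s ∈ Set.Icc γ.left γ.right) (ht : t ∈ Set.Icc γ.left γ.right) :
    |s - t| ≤ K * (dist (γ.ev s) (γ.ev t) + c) := by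
  have h1 := le_dist_ev h hs ht
  have h2 : |s - t| / K ≤ dist (γ.ev s) (γ.ev t) + c := by linarith
  rwa [div_le_iff₀' (by linarith)] at h2

/-- Two points between two points of a quasi-geodesic are at controlled distance. -/
theorem dist_ev_ev_le (hK : 1 ≤ K) (h : IsQIEmbedding K c γ.toFun) {s t u v r : ℝ}
    (hs : γ.left ≤ s) (ht : t ≤ γ.right) (hu : u ∈ Set.Icc s t) (hv : v ∈ Set.Icc s t)
    (hr : dist (γ.ev s) (γ.ev t) ≤ r) :
    dist (γ.ev u) (γ.ev v) ≤ K * (K * (r + c)) + c := by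
  have hst : s ≤ t := hu.1.trans hu.2
  have h1 := abs_sub_le hK h (s := s) (t := t) ⟨hs, hst.trans ht⟩ ⟨hs.trans hst, ht⟩
  have h2 := dist_ev_le h (s := u) (t := v) ⟨hs.trans hu.1, hu.2.trans ht⟩
    ⟨hs.trans hv.1, hv.2.trans ht⟩
  have h3 : |u - v| ≤ |s - t| := by
    rw [abs_sub_comm s t, abs_of_nonneg (sub_nonneg.2 hst), abs_le]
    constructor <;> linarith [hu.1, hu.2, hv.1, hv.2]
  have h4 : K * (dist (γ.ev s) (γ.ev t) + c) ≤ K * (r + c) := by gcongr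
  have h5 : K * |u - v| ≤ K * (K * (r + c)) := by gcongr; linarith
  linarith

end IntervalPath

/-! ### Coarse projections to an orbit and the Behrstock inequality -/

/-- A coarse projection `φ` of `X` to the orbit of `o` under powers of `g`, written as an exponent
of `g`: it is a coarse retraction, and the paths of `PS` between points with different projections
pass near the projections of their endpoints. -/
structure CoarseAxis {G : Type*} [Group G] {X : Type*} [MetricSpace X] [MulAction G X]
    [IsIsometricSMul G X] (PS : Set (IntervalPath X)) (μ : ℝ) (g : G) (o : X) (φ : X → ℤ)
    (C : ℕ) : Prop where
  weak : IsWeakPathSystem G PS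
  one_le : 1 ≤ μ
  quasi : ∀ γ ∈ PS, IsQIEmbedding μ μ γ.toFun
  orbit : ∀ n : ℤ, |φ (g ^ n • o) - n| ≤ C
  near : ∀ δ ∈ PS, (C : ℤ) ≤ |φ δ.source - φ δ.target| →
    (∃ u ∈ Set.Icc δ.left δ.right, dist (δ.ev u) (g ^ φ δ.source • o) ≤ C) ∧
    (∃ u ∈ Set.Icc δ.left δ.right, dist (δ.ev u) (g ^ φ δ.target • o) ≤ C)
  proper : ∀ r : ℝ, ∃ J : ℕ, ∀ n : ℤ, dist (g ^ n • o) o ≤ r → |n| ≤ J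

namespace CoarseAxis

variable {G : Type*} [Group G] {X : Type*} [MetricSpace X] [MulAction G X] [IsIsometricSMul G X]
  {PS : Set (IntervalPath X)} {μ : ℝ} {g : G} {o : X} {φ : X → ℤ} {C : ℕ}

theorem exists_path (H : CoarseAxis PS μ g o φ C) (x y : X) :
    ∃ δ ∈ PS, δ.source = x ∧ δ.target = y := H.weak.isPathSystem.connects x y

theorem near_ev (H : CoarseAxis PS μ g o φ C) {δ : IntervalPath X} (hδ : δ ∈ PS) {s t : ℝ}
    (hs : δ.left ≤ s) (hst : s ≤ t) (ht : t ≤ δ.right)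
    (h : (C : ℤ) ≤ |φ (δ.ev s) - φ (δ.ev t)|) :
    (∃ u ∈ Set.Icc s t, dist (δ.ev u) (g ^ φ (δ.ev s) • o) ≤ C) ∧
    (∃ u ∈ Set.Icc s t, dist (δ.ev u) (g ^ φ (δ.ev t) • o) ≤ C) := by
  have h0 := H.near _ (H.weak.isPathSystem.subpath_mem δ hδ s t hs hst ht)
  have e1 : (δ.subpath s t hs hst ht).source = δ.ev s :=
    (δ.ev_of_mem ⟨hs, hst.trans ht⟩).symm
  have e2 : (δ.subpath s t hs hst ht).target = δ.ev t :=
    (δ.ev_of_mem ⟨hs.trans hst, ht⟩).symm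
  rw [e1, e2] at h0
  obtain ⟨⟨u, hu, h1⟩, ⟨v, hv, h2⟩⟩ := h0 h
  rw [δ.ev_subpath hs hst ht hu] at h1
  rw [δ.ev_subpath hs hst ht hv] at h2
  exact ⟨⟨u, hu, h1⟩, ⟨v, hv, h2⟩⟩

/-- The version of `near_ev` for the translate of the axis by `w`. -/
theorem near_ev_translate (H : CoarseAxis PS μ g o φ C) (w : G) {δ : IntervalPath X} (hδ : δ ∈ PS)
    {s t : ℝ} (hs : δ.left ≤ s) (hst : s ≤ t) (ht : t ≤ δ.right)
    (h : (C : ℤ) ≤ |φ (w⁻¹ • δ.ev s) - φ (w⁻¹ • δ.ev t)|) :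
    (∃ u ∈ Set.Icc s t, dist (δ.ev u) (w • g ^ φ (w⁻¹ • δ.ev s) • o) ≤ C) ∧
    (∃ u ∈ Set.Icc s t, dist (δ.ev u) (w • g ^ φ (w⁻¹ • δ.ev t) • o) ≤ C) := by
  have h0 := H.near_ev (H.weak.translate_mem w⁻¹ δ hδ) (s := s) (t := t) hs hst ht h
  change (∃ u ∈ Set.Icc s t, dist (w⁻¹ • δ.ev u) (g ^ φ (w⁻¹ • δ.ev s) • o) ≤ C) ∧
    (∃ u ∈ Set.Icc s t, dist (w⁻¹ • δ.ev u) (g ^ φ (w⁻¹ • δ.ev t) • o) ≤ C) at h0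
  simpa only [dist_inv_smul] using h0

theorem proper_sub (H : CoarseAxis PS μ g o φ C) (r : ℝ) :
    ∃ J : ℕ, ∀ n m : ℤ, dist (g ^ n • o) (g ^ m • o) ≤ r → |n - m| ≤ J := by
  obtain ⟨J, hJ⟩ := H.proper r
  exact ⟨J, fun n m h => hJ _ (by rwa [← dist_zpow_smul_zpow_smul])⟩

/-- A coarse projection is coarsely Lipschitz. -/
theorem bornologous (H : CoarseAxis PS μ g o φ C) (r : ℝ) :
    ∃ J : ℕ, ∀ x y : X, dist x y ≤ r → |φ x - φ y| ≤ J := by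
  obtain ⟨J, hJ⟩ := H.proper_sub (C + (μ * (μ * (r + μ)) + μ) + C)
  refine ⟨max J C, fun x y hxy => ?_⟩
  by_cases hC : (C : ℤ) ≤ |φ x - φ y|
  -- A path between nearby points has bounded diameter, yet it passes near both projections;
  -- properness turns their distance into a bound on exponents.
  · obtain ⟨δ, hδ, rfl, rfl⟩ := H.exists_path x y
    obtain ⟨⟨u, hu, h1⟩, ⟨v, hv, h2⟩⟩ := H.near δ hδ hC
    have h3 := IntervalPath.dist_ev_ev_le H.one_le (H.quasi δ hδ) le_rfl le_rfl hu hv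
      (r := r) (by rwa [δ.ev_left, δ.ev_right])
    have h4 := hJ (φ δ.source) (φ δ.target) (by
      have := dist_triangle4 (g ^ φ δ.source • o) (δ.ev u) (δ.ev v) (g ^ φ δ.target • o)
      rw [dist_comm _ (δ.ev u)] at this
      linarith)
    push_cast
    simp only [abs_le, le_abs] at *
    omega
  · push_cast
    simp only [abs_le, le_abs] at *
    omega

/-- Along a path of `PS` from a point to its projection, the projection is coarsely constant. -/
theorem exists_path_to_projection (H : CoarseAxis PS μ g o φ C) :
    ∃ K : ℕ, ∀ δ ∈ PS, δ.target = g ^ φ δ.source • o → ∀ s ∈ Set.Icc δ.left δ.right,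
      |φ (δ.ev s) - φ δ.source| ≤ K := by
  obtain ⟨J, hJ⟩ := H.bornologous (μ * (μ * (C + μ)) + μ)
  refine ⟨J + C, fun δ hδ ht s hs => ?_⟩
  by_cases hC : (C : ℤ) ≤ |φ (δ.ev δ.left) - φ (δ.ev s)|
  -- If the projection has moved by time `s`, the path was already near its final point at some time
  -- `v ≤ s`, so it stays near that point from `v` on.
  · obtain ⟨⟨v, hv, h1⟩, -⟩ := H.near_ev hδ le_rfl hs.1 hs.2 hC
    rw [δ.ev_left, ← ht, ← δ.ev_right] at h1
    have h2 := hJ _ _ (IntervalPath.dist_ev_ev_le H.one_le (H.quasi δ hδ) hv.1 le_rfl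
      ⟨hv.2, hs.2⟩ (v := δ.right) ⟨hv.2.trans hs.2, le_rfl⟩ h1)
    have h3 := H.orbit (φ δ.source)
    rw [δ.ev_right, ht] at h2
    push_cast
    simp only [abs_le, le_abs] at *
    omega
  · rw [δ.ev_left] at hC
    push_cast
    simp only [abs_le, le_abs] at *
    omega

/-- Any two coarse projections to the same orbit are close. -/
theorem close (H : CoarseAxis PS μ g o φ C) : ∃ E : ℕ, ∀ φ' : X → ℤ, CoarseAxis PS μ g o φ' C →
    ∀ x, |φ' x - φ x| ≤ E := by
  obtain ⟨K, hK⟩ := H.exists_path_to_projection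
  obtain ⟨J, hJ⟩ := H.bornologous C
  refine ⟨K + J + 2 * C, fun φ' H' x => ?_⟩
  obtain ⟨δ, hδ, rfl, ht⟩ := H.exists_path x (g ^ φ x • o)
  have h0 := H'.orbit (φ δ.source)
  by_cases hC : (C : ℤ) ≤ |φ' δ.source - φ' δ.target|
  -- The path passes near the `φ'`-projection of its source, while `φ` is coarsely constant along
  -- it.
  · obtain ⟨⟨s, hs, h1⟩, -⟩ := H'.near δ hδ hC
    have h2 := hK δ hδ ht s hs
    have h3 := hJ _ _ h1
    have h4 := H.orbit (φ' δ.source)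
    push_cast
    simp only [abs_le, le_abs] at *
    omega
  · rw [ht] at hC
    push_cast
    simp only [abs_le, le_abs] at *
    omega

/-- The constant `C` does not change, so `close` compares all these projections with `φ` by an error
independent of `n`; this is coarse equivariance. -/
theorem translate (H : CoarseAxis PS μ g o φ C) (n : ℤ) :
    CoarseAxis PS μ g o (fun x => φ (g ^ n • x) - n) C := by
  refine ⟨H.weak, H.one_le, H.quasi, fun m => ?_, fun δ hδ h => ?_, H.proper⟩
  · have := H.orbit (n + m)
    rw [zpow_add, mul_smul] at this
    simp only [abs_le] at *
    omega
  · have h0 := H.near_ev_translate (g ^ n)⁻¹ hδ le_rfl δ.le le_rfl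
    simp only [inv_inv, δ.ev_left, δ.ev_right] at h0
    have h1 := h0 (by simpa using h)
    simpa only [← zpow_neg, smul_smul, ← zpow_add, neg_add_eq_sub] using h1

/-- A coarse projection is coarsely equivariant. -/
theorem equivariant (H : CoarseAxis PS μ g o φ C) :
    ∃ E : ℕ, ∀ (n : ℤ) (x : X), |φ (g ^ n • x) - φ x - n| ≤ E := by
  obtain ⟨E, hE⟩ := H.close
  refine ⟨E, fun n x => ?_⟩
  have := hE _ (H.translate n) x
  simp only [abs_le] at *
  omega

/-- The Behrstock inequality for two translates of an axis with bounded projections to each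
other. -/
theorem behrstock (H : CoarseAxis PS μ g o φ C) (B₀ : ℕ) : ∃ B : ℕ, ∀ u : G,
    (∀ n m : ℤ, |φ (u • g ^ n • o) - φ (u • g ^ m • o)| ≤ B₀) →
    (∀ n m : ℤ, |φ (u⁻¹ • g ^ n • o) - φ (u⁻¹ • g ^ m • o)| ≤ B₀) →
    ∀ x : X, (∀ n : ℤ, |φ x - φ (u • g ^ n • o)| ≤ B) ∨
      (∀ n : ℤ, |φ (u⁻¹ • x) - φ (u⁻¹ • g ^ n • o)| ≤ B) := by
  obtain ⟨K, hK⟩ := H.exists_path_to_projection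
  obtain ⟨J, hJ⟩ := H.bornologous C
  refine ⟨K + J + B₀ + C, fun u hu hu' x => ?_⟩
  -- Follow a path from the point to its projection on the `u`-translate. Either it comes near the
  -- axis, where the `u`-projection is already that of the axis, or its two ends have nearly the
  -- same `φ`.
  obtain ⟨δ, hδ, rfl, ht⟩ := H.exists_path x (u • g ^ φ (u⁻¹ • x) • o)
  by_cases hC : (C : ℤ) ≤ |φ δ.source - φ δ.target|
  · right
    intro n
    obtain ⟨⟨s, hs, h1⟩, -⟩ := H.near δ hδ hC
    have h2 : |φ (u⁻¹ • δ.ev s) - φ (u⁻¹ • δ.source)| ≤ K :=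
      hK (δ.translate u⁻¹) (H.weak.translate_mem _ _ hδ)
        (show u⁻¹ • δ.target = _ by rw [ht, inv_smul_smul]; rfl) s hs
    have h3 := hJ (u⁻¹ • δ.ev s) (u⁻¹ • g ^ φ δ.source • o) (by rwa [dist_smul])
    have h4 := hu' (φ δ.source) n
    push_cast
    simp only [abs_le, le_abs] at *
    omega
  · left
    intro n
    have h1 := hu (φ (u⁻¹ • δ.source)) n
    rw [← ht] at h1
    push_cast
    simp only [abs_le, le_abs] at *
    omega

end CoarseAxis

/-- Discrete intermediate value theorem for sequences with bounded jumps. -/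
theorem exists_mem_Icc_of_bounded_jumps (u : ℕ → ℤ) (n J : ℕ) (a : ℤ) (h0 : u 0 ≤ a)
    (hn : a ≤ u n) (hJ : ∀ i < n, |u (i + 1) - u i| ≤ J) :
    ∃ i ≤ n, a ≤ u i ∧ u i ≤ a + J := by
  classical
  have hex : ∃ i, a ≤ u i := ⟨n, hn⟩
  have hle : Nat.find hex ≤ n := Nat.find_min' hex hn
  refine ⟨Nat.find hex, hle, Nat.find_spec hex, ?_⟩
  rcases hi : Nat.find hex with _ | i
  · omega
  · have h1 := Nat.find_min hex (m := i) (by omega)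
    have h2 := hJ i (by omega)
    rw [abs_le] at h2
    omega

/-! ### Contracting orbits are Morse -/

namespace CoarseAxis

variable {G : Type*} [Group G] {X : Type*} [MetricSpace X] [MulAction G X] [IsIsometricSMul G X]
  {PS : Set (IntervalPath X)} {μ : ℝ} {g : G} {o : X} {φ : X → ℤ} {C : ℕ}

/-- Points near the orbit are near their projection. -/
theorem exists_dist_projection_le (H : CoarseAxis PS μ g o φ C) (r : ℝ) :
    ∃ R : ℝ, ∀ (x : X) (n : ℤ), dist x (g ^ n • o) ≤ r → dist x (g ^ φ x • o) ≤ R := by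
  obtain ⟨J, hJ⟩ := H.bornologous r
  refine ⟨r + (J + C : ℕ) * dist (g • o) o, fun x n h => ?_⟩
  have h1 := hJ _ _ h
  have h2 := H.orbit n
  have h3 : |n - φ x| ≤ ((J + C : ℕ) : ℤ) := by
    push_cast
    simp only [abs_le] at *
    omega
  have h4 := dist_zpow_smul_le_of_abs_le g o h3
  rw [Int.cast_natCast] at h4
  linarith [dist_triangle x (g ^ n • o) (g ^ φ x • o)]

/-- Points with different projections are not far from the orbit in comparison with their
distance. -/
theorem dist_projection_le (H : CoarseAxis PS μ g o φ C) {x y : X} {r : ℝ} (hr : dist x y ≤ r)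
    (h : (C : ℤ) ≤ |φ x - φ y|) :
    dist x (g ^ φ x • o) ≤ μ * (μ * (r + μ)) + μ + C ∧
      dist y (g ^ φ y • o) ≤ μ * (μ * (r + μ)) + μ + C := by
  obtain ⟨δ, hδ, rfl, rfl⟩ := H.exists_path x y
  obtain ⟨⟨u, hu, h1⟩, ⟨v, hv, h2⟩⟩ := H.near δ hδ h
  have h3 := IntervalPath.dist_ev_ev_le H.one_le (H.quasi δ hδ) le_rfl le_rfl
    (u := δ.left) (v := u) (r := r) ⟨le_rfl, δ.le⟩ hu (by rwa [δ.ev_left, δ.ev_right])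
  have h4 := IntervalPath.dist_ev_ev_le H.one_le (H.quasi δ hδ) le_rfl le_rfl
    (u := δ.right) (v := v) (r := r) ⟨δ.le, le_rfl⟩ hv (by rwa [δ.ev_left, δ.ev_right])
  rw [δ.ev_left] at h3
  rw [δ.ev_right] at h4
  constructor
  · linarith [dist_triangle δ.source (δ.ev u) (g ^ φ δ.source • o)]
  · linarith [dist_triangle δ.target (δ.ev v) (g ^ φ δ.target • o)]

/-- During an excursion away from the orbit the projected exponent changes by at most `C` per step,
so the projection moves at speed at most `C * dist (g • o) o`. The sequence itself progresses faster
by `1` per step, which bounds the duration of an excursion by `2 * R + c`. -/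
theorem exists_dist_le_of_sequence (H : CoarseAxis PS μ g o φ C) {S c R : ℝ} (hS : 0 ≤ S)
    (hR : μ * (μ * (S + μ)) + μ + C ≤ R) (x : ℕ → X) (n : ℕ)
    (hx : ∀ i < n, dist (x i) (x (i + 1)) ≤ S)
    (hlow : ∀ i j, i ≤ j → j ≤ n →
      (C * dist (g • o) o + 1) * ((j : ℝ) - i) - c ≤ dist (x i) (x j))
    (h0 : dist (x 0) (g ^ φ (x 0) • o) ≤ R) (hn : dist (x n) (g ^ φ (x n) • o) ≤ R)
    {i : ℕ} (hi : i ≤ n) : ∃ m : ℤ, dist (x i) (g ^ m • o) ≤ R + S * (2 * R + c) := by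
  classical
  let P : ℕ → Prop := fun j => dist (x j) (g ^ φ (x j) • o) ≤ R
  -- `a` is the last index up to `i`, and `b` the first index from `i` on, at which the sequence is
  -- `R`-close to its projection.
  let a := Nat.findGreatest P i
  have ha : a ≤ i := Nat.findGreatest_le i
  have hPa : P a := Nat.findGreatest_spec (P := P) (Nat.zero_le i) h0
  have hex : ∃ b, i ≤ b ∧ P b := ⟨n, hi, hn⟩
  obtain ⟨hib, hPb⟩ := Nat.find_spec hex
  have hbn : Nat.find hex ≤ n := Nat.find_min' hex ⟨hi, hn⟩
  set b := Nat.find hex with hb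
  have hstep : ∀ k, a ≤ k → k < b → |φ (x k) - φ (x (k + 1))| ≤ C := by
    intro k hak hkb
    by_contra hcon
    obtain ⟨h1, h2⟩ := H.dist_projection_le (hx k (by omega)) (not_le.1 hcon).le
    rcases lt_or_ge k i with hki | hki
    · exact Nat.findGreatest_is_greatest (P := P) (n := i) (k := k + 1) (by omega) hki
        (h2.trans hR)
    · exact Nat.find_min hex hkb ⟨hki, h1.trans hR⟩
  have hsum : ∀ k, a + k ≤ b → |φ (x a) - φ (x (a + k))| ≤ C * k := by
    intro k
    induction k with
    | zero => simp
    | succ k ih =>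
      intro hk
      have h1 := ih (by omega)
      have h2 := hstep (a + k) (by omega) (by omega)
      push_cast
      rw [mul_add]
      rw [add_assoc] at h2
      simp only [abs_le] at *
      omega
  have hdist : ∀ k, a + k ≤ n → dist (x a) (x (a + k)) ≤ S * k := by
    intro k
    induction k with
    | zero => simp
    | succ k ih =>
      intro hk
      have h1 := ih (by omega)
      have h2 := hx (a + k) (by omega)
      have := dist_triangle (x a) (x (a + k)) (x (a + k + 1))
      push_cast
      rw [← add_assoc]
      linarith
  obtain ⟨k, hk⟩ := Nat.exists_eq_add_of_le (ha.trans hib)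
  obtain ⟨k', hk'⟩ := Nat.exists_eq_add_of_le ha
  have h1 := dist_zpow_smul_le_of_abs_le g o (hsum k hk.ge)
  rw [← hk] at h1
  have h2 := hlow a b (ha.trans hib) hbn
  have h3 := dist_triangle4 (x a) (g ^ φ (x a) • o) (g ^ φ (x b) • o) (x b)
  rw [dist_comm (g ^ φ (x b) • o) (x b)] at h3
  have hPa' : dist (x a) (g ^ φ (x a) • o) ≤ R := hPa
  have hPb' : dist (x b) (g ^ φ (x b) • o) ≤ R := hPb
  have hbk : (b : ℝ) - a = k := by rw [hk]; push_cast; ring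
  rw [hbk] at h2
  push_cast at h1
  have h4 : (k : ℝ) ≤ 2 * R + c := by nlinarith
  have h5 := hdist k' (by omega)
  rw [← hk'] at h5
  have h6 : (k' : ℝ) ≤ k := by exact_mod_cast (by omega : k' ≤ k)
  refine ⟨φ (x a), ?_⟩
  have h7 : S * k' ≤ S * (2 * R + c) := by gcongr; linarith
  have h8 := dist_triangle (x i) (x a) (g ^ φ (x a) • o)
  rw [dist_comm (x i) (x a)] at h8
  linarith

/-- Contracting orbits are Morse. -/
theorem exists_dist_quasiGeodesic_le (H : CoarseAxis PS μ g o φ C) {K c : ℝ} (hK : 1 ≤ K)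
    (hc : 0 ≤ c) (R : ℝ) : ∃ D : ℝ, ∀ γ : IntervalPath X, IsQIEmbedding K c γ.toFun →
      (∃ m : ℤ, dist γ.source (g ^ m • o) ≤ R) → (∃ m : ℤ, dist γ.target (g ^ m • o) ≤ R) →
      ∀ t ∈ Set.Icc γ.left γ.right, ∃ m : ℤ, dist (γ.ev t) (g ^ m • o) ≤ D := by
  set L : ℝ := C * dist (g • o) o + 1 with hL
  have hL1 : 1 ≤ L := by
    have : 0 ≤ (C : ℝ) * dist (g • o) o := by positivity
    linarith
  -- Sampling with time step `K * L` turns the lower quasi-geodesic bound into slope `L`, the slope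
  -- required by `exists_dist_le_of_sequence`.
  set η : ℝ := K * L with hη
  have hη0 : 0 < η := by positivity
  set S : ℝ := K * η + c with hS
  have hS0 : 0 ≤ S := by positivity
  obtain ⟨R₁, hR₁⟩ := H.exists_dist_projection_le (R + S)
  set R₂ := max R₁ (μ * (μ * (S + μ)) + μ + C) with hR₂
  refine ⟨R₂ + S * (2 * R₂ + c) + S, fun γ hγ ⟨m₀, hm₀⟩ ⟨m₁, hm₁⟩ t ht => ?_⟩
  set x : ℕ → X := fun i => γ.ev (γ.left + i * η) with hx
  set n := ⌊(γ.right - γ.left) / η⌋₊ with hn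
  have hfloor : ∀ s ∈ Set.Icc γ.left γ.right,
      (⌊(s - γ.left) / η⌋₊ : ℝ) * η ≤ s - γ.left ∧
      s - γ.left ≤ (⌊(s - γ.left) / η⌋₊ : ℝ) * η + η := by
    intro s hs
    have h0 : 0 ≤ (s - γ.left) / η := div_nonneg (by linarith [hs.1]) hη0.le
    have h1 := Nat.floor_le h0
    have h2 := (Nat.lt_floor_add_one ((s - γ.left) / η)).le
    rw [le_div_iff₀ hη0] at h1
    rw [div_le_iff₀ hη0] at h2
    constructor <;> linarith
  have hright : γ.right ∈ Set.Icc γ.left γ.right := ⟨γ.le, le_rfl⟩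
  have hmem : ∀ i ≤ n, γ.left + i * η ∈ Set.Icc γ.left γ.right := by
    intro i hi
    have h1 := (hfloor _ hright).1
    have h2 : (i : ℝ) * η ≤ n * η := by gcongr
    have h3 : 0 ≤ (i : ℝ) * η := by positivity
    constructor <;> linarith
  have hnear : ∀ s ∈ Set.Icc γ.left γ.right, ⌊(s - γ.left) / η⌋₊ ≤ n →
      dist (γ.ev s) (x ⌊(s - γ.left) / η⌋₊) ≤ S := by
    intro s hs hle
    obtain ⟨h1, h2⟩ := hfloor s hs
    refine (IntervalPath.dist_ev_le hγ hs (hmem _ hle)).trans ?_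
    have : |s - (γ.left + ⌊(s - γ.left) / η⌋₊ * η)| ≤ η := by
      rw [abs_le]; constructor <;> linarith
    rw [hS]
    gcongr
  have hle : ⌊(t - γ.left) / η⌋₊ ≤ n := by
    apply Nat.floor_mono
    gcongr
    exact ht.2
  obtain ⟨m, hm⟩ := H.exists_dist_le_of_sequence (S := S) (c := c) (R := R₂) hS0 (le_max_right _ _)
    x n (fun i hi => by
      refine (IntervalPath.dist_ev_le hγ (hmem _ hi.le) (hmem (i + 1) hi)).trans ?_
      rw [hS]
      have : |γ.left + i * η - (γ.left + ((i + 1 : ℕ) : ℝ) * η)| = η := by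
        push_cast
        rw [show γ.left + i * η - (γ.left + (i + 1) * η) = -η by ring, abs_neg, abs_of_pos hη0]
      rw [this])
    (fun i j hij hj => by
      refine le_trans ?_ (IntervalPath.le_dist_ev hγ (hmem i (hij.trans hj)) (hmem j hj))
      have hij' : (i : ℝ) ≤ j := by exact_mod_cast hij
      have : |γ.left + i * η - (γ.left + j * η)| = K * (L * (j - i)) := by
        rw [abs_sub_comm, abs_of_nonneg]
        · rw [hη]; ring
        · have : (i : ℝ) * η ≤ j * η := by gcongr
          linarith
      rw [this, mul_div_cancel_left₀ _ (by positivity)])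
    ((hR₁ _ m₀ (by
      have : x 0 = γ.source := by simp [hx, γ.ev_left]
      rw [this]; linarith)).trans (le_max_left _ _))
    ((hR₁ _ m₁ (by
      have := hnear γ.right hright le_rfl
      rw [γ.ev_right, dist_comm] at this
      exact (dist_triangle _ _ _).trans (by linarith))).trans (le_max_left _ _)) hle
  refine ⟨m, ?_⟩
  linarith [dist_triangle (γ.ev t) (x ⌊(t - γ.left) / η⌋₊) (g ^ m • o), hnear t ht hle]

theorem isMorse_orbit (H : CoarseAxis PS μ g o φ C) (x : X) :
    IsMorse (Set.range fun n : ℤ => g ^ n • x) := by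
  intro K c hK hc
  obtain ⟨D, hD⟩ := H.exists_dist_quasiGeodesic_le hK hc (dist x o)
  refine ⟨D + dist x o, fun γ hγ ⟨m₀, h₀⟩ ⟨m₁, h₁⟩ p hp => ?_⟩
  obtain ⟨t, ht, rfl⟩ := γ.exists_ev_eq hp
  obtain ⟨m, hm⟩ := hD γ hγ ⟨m₀, by rw [← h₀, dist_smul]⟩ ⟨m₁, by rw [← h₁, dist_smul]⟩ t ht
  refine (Metric.infDist_le_dist_of_mem (Set.mem_range_self m)).trans ?_
  have := dist_triangle (γ.ev t) (g ^ m • o) (g ^ m • x)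
  rw [dist_smul, dist_comm o] at this
  exact this.trans (by linarith)

theorem isContracting_orbit (H : CoarseAxis PS μ g o φ C) :
    IsContracting PS (Set.range fun n : ℤ => g ^ n • o) := by
  set d := dist (g • o) o
  refine ⟨C + C * d + 1, fun x => g ^ φ x • o, fun x => ⟨_, rfl⟩, ?_, fun x y hxy δ hδ hs ht => ?_⟩
  · rintro _ ⟨n, rfl⟩
    have h1 := dist_zpow_smul_le_of_abs_le g o (H.orbit n)
    rw [Int.cast_natCast] at h1
    have : (0 : ℝ) ≤ C := by positivity
    exact h1.trans (by linarith)
  · subst hs ht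
    have hC : (C : ℤ) ≤ |φ δ.source - φ δ.target| := by
      by_contra hcon
      have h1 := dist_zpow_smul_le_of_abs_le g o (not_le.1 hcon).le
      rw [Int.cast_natCast] at h1
      have : (0 : ℝ) ≤ C := by positivity
      linarith
    have h0 : (C : ℝ) ≤ C + C * d + 1 := by
      have : 0 ≤ (C : ℝ) * d := by positivity
      linarith
    obtain ⟨⟨u, hu, h1⟩, ⟨v, hv, h2⟩⟩ := H.near δ hδ hC
    rw [dist_comm] at h1 h2
    exact ⟨((Metric.infDist_le_dist_of_mem (δ.ev_mem_image u)).trans h1).trans h0,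
      ((Metric.infDist_le_dist_of_mem (δ.ev_mem_image v)).trans h2).trans h0⟩

/-- If a translate of the orbit projects to both sides of a point of the orbit, then it passes near
that point. -/
theorem exists_dist_translate_le (H : CoarseAxis PS μ g o φ C) :
    ∃ D : ℝ, ∀ (h : G) (a n m : ℤ), φ (h • g ^ n • o) + C ≤ a → a ≤ φ (h • g ^ m • o) →
      ∃ k : ℤ, dist (h • g ^ k • o) (g ^ a • o) ≤ D := by
  have hμ0 : 0 ≤ μ := zero_le_one.trans H.one_le
  obtain ⟨J, hJ⟩ := H.bornologous (μ * 1 + μ)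
  obtain ⟨D, hD⟩ := H.exists_dist_quasiGeodesic_le H.one_le hμ0 0
  refine ⟨D + (C + J * dist (g • o) o), fun h a n m hn hm => ?_⟩
  obtain ⟨δ, hδ, hs, ht⟩ := H.exists_path (h • g ^ n • o) (h • g ^ m • o)
  let τ : ℕ → ℝ := fun i => min (δ.left + i) δ.right
  have hτ : ∀ i, τ i ∈ Set.Icc δ.left δ.right := fun i =>
    ⟨le_min (by simp) δ.le, min_le_right _ _⟩
  -- At unit time steps `φ` has bounded jumps, so it comes close to `a` somewhere along the path.
  obtain ⟨i, -, hi1, hi2⟩ := exists_mem_Icc_of_bounded_jumps (fun i => φ (δ.ev (τ i)))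
    ⌈δ.right - δ.left⌉₊ J a
    (by
      have : τ 0 = δ.left := by simp [τ, δ.le]
      simp only [this, δ.ev_left, hs]
      omega)
    (by
      have : τ ⌈δ.right - δ.left⌉₊ = δ.right :=
        min_eq_right (by linarith [Nat.le_ceil (δ.right - δ.left)])
      simpa only [this, δ.ev_right, ht] using hm)
    (fun i _ => hJ _ _ ((IntervalPath.dist_ev_le (H.quasi δ hδ) (hτ _) (hτ _)).trans (by
      have : |τ (i + 1) - τ i| ≤ 1 := by
        refine (abs_min_sub_min_le_max _ _ _ _).trans ?_
        simp
      gcongr)))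
  have hC : (C : ℤ) ≤ |φ (δ.ev δ.left) - φ (δ.ev (τ i))| := by
    rw [δ.ev_left, hs, le_abs]
    omega
  obtain ⟨-, u, hu, h1⟩ := H.near_ev hδ le_rfl (hτ i).1 (hτ i).2 hC
  -- Pulled back by `h`, the path is a quasi-geodesic with endpoints on the orbit, so it stays near
  -- the orbit.
  obtain ⟨k, hk⟩ := hD (δ.translate h⁻¹) (H.quasi _ (H.weak.translate_mem _ _ hδ))
    ⟨n, by change dist (h⁻¹ • δ.source) _ ≤ 0; simp [hs]⟩
    ⟨m, by change dist (h⁻¹ • δ.target) _ ≤ 0; simp [ht]⟩ u ⟨hu.1, hu.2.trans (hτ i).2⟩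
  change dist (h⁻¹ • δ.ev u) (g ^ k • o) ≤ D at hk
  rw [dist_inv_smul, dist_comm] at hk
  have h2 : |φ (δ.ev (τ i)) - a| ≤ J := by
    rw [abs_le]; omega
  have h3 := dist_zpow_smul_le_of_abs_le g o h2
  rw [Int.cast_natCast] at h3
  refine ⟨k, ?_⟩
  linarith [dist_triangle4 (h • g ^ k • o) (δ.ev u) (g ^ φ (δ.ev (τ i)) • o) (g ^ a • o)]

end CoarseAxis

/-! ### Commensuration and properness -/

/-- `h` commensurates the subgroup generated by `g`, by conjugation of powers. -/
def Commensurates {G : Type*} [Group G] (g h : G) : Prop :=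
  ∃ p q : ℤ, p ≠ 0 ∧ q ≠ 0 ∧ h * g ^ p * h⁻¹ = g ^ q

namespace Commensurates

variable {G : Type*} [Group G] {g h : G}

theorem inv (H : Commensurates g h) : Commensurates g h⁻¹ := by
  obtain ⟨p, q, hp, hq, e⟩ := H
  refine ⟨q, p, hq, hp, ?_⟩
  rw [← e]
  group

theorem mul_zpow (H : Commensurates g h) (n : ℤ) : Commensurates g (h * g ^ n) := by
  obtain ⟨p, q, hp, hq, e⟩ := H
  refine ⟨p, q, hp, hq, ?_⟩
  rw [← e]
  group

end Commensurates

/-- The finiteness condition of the definition of WPD, at one point. -/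
def ProperAlong {G : Type*} [Group G] {X : Type*} [MetricSpace X] [MulAction G X] (g : G)
    (x : X) : Prop :=
  ∀ R : ℝ, 0 ≤ R → ∃ N : ℕ,
    {h : G | dist x (h • x) ≤ R ∧ dist (h • g ^ N • x) (g ^ N • x) ≤ R}.Finite

namespace CoarseAxis

variable {G : Type*} [Group G] {X : Type*} [MetricSpace X] [MulAction G X] [IsIsometricSMul G X]
  {PS : Set (IntervalPath X)} {μ : ℝ} {g : G} {o : X} {φ : X → ℤ} {C : ℕ}

theorem zpow_eq_one (H : CoarseAxis PS μ g o φ C) {n : ℤ} (hn : g ^ n = 1) : n = 0 := by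
  obtain ⟨J, hJ⟩ := H.proper 0
  by_contra h0
  have h1 := hJ (n * (J + 1)) (by rw [zpow_mul, hn, one_zpow, one_smul, dist_self])
  rw [abs_mul, abs_of_nonneg (by positivity : (0 : ℤ) ≤ J + 1)] at h1
  have h2 := Int.one_le_abs h0
  nlinarith

/-- Only finitely many group elements match the orbit up to bounded distance near `o` and near a
far away point. -/
theorem finite_matching (H : CoarseAxis PS μ g o φ C) (hg : ProperAlong g o) (D : ℝ) :
    ∃ N : ℕ, {e : G | dist (e • o) o ≤ D ∧
      ∃ j : ℤ, dist (e • g ^ j • o) (g ^ N • o) ≤ D}.Finite := by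
  rcases lt_or_ge D 0 with hD | hD
  · refine ⟨0, Set.finite_empty.subset fun e he => ?_⟩
    exact absurd (dist_nonneg.trans he.1) (not_le.2 hD)
  obtain ⟨N, hN⟩ := hg (2 * D) (by positivity)
  obtain ⟨J, hJ⟩ := H.proper (D + dist (g ^ N • o) o + D)
  refine ⟨N, ((Set.finite_Icc (-J : ℤ) J).biUnion
    (t := fun j => {e : G | dist (e • o) o ≤ D ∧ dist (e • g ^ j • o) (g ^ N • o) ≤ D})
    fun j _ => ?_).subset ?_⟩
  · rcases Set.eq_empty_or_nonempty
      {e : G | dist (e • o) o ≤ D ∧ dist (e • g ^ j • o) (g ^ N • o) ≤ D} with h0 | ⟨e₀, h0, h1⟩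
    · rw [h0]
      exact Set.finite_empty
    -- For fixed `j`, the quotient of two such elements moves both `o` and `g ^ N • o` by at most `2
    -- * D`, hence the radius in the choice of `N`.
    · refine (hN.preimage (f := fun e => e * e₀⁻¹)
        (mul_left_injective e₀⁻¹).injOn).subset ?_
      rintro e ⟨h2, h3⟩
      refine ⟨?_, ?_⟩
      · have h4 : dist (e • o) ((e * e₀⁻¹) • o) ≤ D := by
          rw [mul_smul, dist_smul, dist_comm, dist_inv_smul, dist_comm]
          exact h0
        rw [dist_comm] at h2
        linarith [dist_triangle o (e • o) ((e * e₀⁻¹) • o)]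
      · have h4 : dist ((e * e₀⁻¹) • g ^ N • o) (e • g ^ j • o) ≤ D := by
          rw [mul_smul, dist_smul, dist_inv_smul, dist_comm]
          exact h1
        linarith [dist_triangle ((e * e₀⁻¹) • g ^ N • o) (e • g ^ j • o) (g ^ N • o)]
  · rintro e ⟨h0, j, h1⟩
    have h2 := hJ j (by
      have := dist_triangle4 (e • g ^ j • o) (g ^ N • o) o (e • o)
      rw [dist_smul, dist_comm o] at this
      linarith)
    rw [Set.mem_iUnion₂]
    exact ⟨j, by rwa [Set.mem_Icc, ← abs_le], h0, h1⟩

/-- Since `h * g ^ (p * i) = g ^ (q * i) * h`, the projection of `h • g ^ (p * i) • o` is `q * i` up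
to a constant. Taking `i` to be a multiple of `q` makes the sign of `q` irrelevant. -/
theorem unbounded_of_commensurates (H : CoarseAxis PS μ g o φ C) {h : G} (hh : Commensurates g h)
    (a : ℤ) : (∃ n : ℤ, a ≤ φ (h • g ^ n • o)) ∧ ∃ n : ℤ, φ (h • g ^ n • o) ≤ a := by
  obtain ⟨p, q, -, hq, e⟩ := hh
  obtain ⟨E, hE⟩ := H.equivariant
  have key : ∀ i : ℤ, |φ (h • g ^ (p * i) • o) - φ (h • o) - q * i| ≤ E := by
    intro i
    have : h * g ^ (p * i) = g ^ (q * i) * h := by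
      rw [zpow_mul, zpow_mul, ← e, conj_zpow]
      group
    rw [← mul_smul, this, mul_smul]
    exact hE _ _
  have hqq : 1 ≤ q * q := by
    have : 0 < q * q := mul_self_pos.2 hq
    omega
  set M : ℤ := |a| + |φ (h • o)| + E with hM
  have hMa := le_abs_self a
  have hMa' := neg_abs_le a
  have hMb := le_abs_self (φ (h • o))
  have hMb' := neg_abs_le (φ (h • o))
  have hM0 : 0 ≤ M := by positivity
  have h3 : M ≤ q * (q * M) := by nlinarith
  constructor
  · refine ⟨p * (q * M), ?_⟩
    have h1 := (abs_le.1 (key (q * M))).1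
    omega
  · refine ⟨p * (-(q * M)), ?_⟩
    have h1 := (abs_le.1 (key (-(q * M)))).2
    rw [mul_neg q (q * M)] at h1
    omega

/-- The cyclic group generated by `g` has finite index in its commensurator. -/
theorem finite_commensurates (H : CoarseAxis PS μ g o φ C) (hg : ProperAlong g o) :
    ∃ F : Set G, F.Finite ∧ ∀ h, Commensurates g h → ∃ e ∈ F, ∃ k : ℤ, h = e * g ^ k := by
  obtain ⟨D, hD⟩ := H.exists_dist_translate_le
  obtain ⟨N, hN⟩ := H.finite_matching hg D
  have cross : ∀ h, Commensurates g h → ∀ a : ℤ, ∃ k : ℤ, dist (h • g ^ k • o) (g ^ a • o) ≤ D := by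
    intro h hh a
    obtain ⟨n, hn⟩ := (H.unbounded_of_commensurates hh (a - C)).2
    obtain ⟨m, hm⟩ := (H.unbounded_of_commensurates hh a).1
    exact hD h a n m (by omega) hm
  refine ⟨_, hN, fun h hh => ?_⟩
  -- The translated orbit passes near `o` and near `g ^ N • o`, so after a shift by a power of `g`
  -- the element lies in the finite matching set.
  obtain ⟨k, hk⟩ := cross h hh 0
  obtain ⟨k', hk'⟩ := cross h hh N
  refine ⟨h * g ^ k, ⟨?_, k' - k, ?_⟩, -k, by group⟩
  · simpa [mul_smul] using hk
  · rw [smul_smul, mul_assoc, ← zpow_add, add_sub_cancel, mul_smul]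
    simpa using hk'

/-- Translates of the orbit by elements that do not commensurate `g` have uniformly bounded
projection. -/
theorem bounded_projection (H : CoarseAxis PS μ g o φ C) (hg : ProperAlong g o) :
    ∃ B : ℕ, ∀ h, ¬ Commensurates g h →
      ∀ n m : ℤ, |φ (h • g ^ n • o) - φ (h • g ^ m • o)| ≤ B := by
  obtain ⟨D, hD⟩ := H.exists_dist_translate_le
  obtain ⟨N, hN⟩ := H.finite_matching hg D
  set s := hN.toFinset.card with hs
  refine ⟨C + N + s, fun h hh => ?_⟩
  suffices key : ∀ n m : ℤ, φ (h • g ^ m • o) - φ (h • g ^ n • o) ≤ C + N + s by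
    intro n m
    rw [abs_le]
    have := key n m
    have := key m n
    push_cast
    omega
  intro n m
  by_contra hcon
  apply hh
  set a := φ (h • g ^ n • o) + C with ha
  have cross : ∀ b : ℕ, b ≤ N + s → ∃ k : ℤ, dist (h • g ^ k • o) (g ^ (a + b) • o) ≤ D := by
    intro b hb
    exact hD h (a + b) n m (by omega) (by omega)
  choose! k hk using cross
  -- A long projection gives `s + 1` matching elements in a set of size `s`. Two coincide, and their
  -- equality says that `h` conjugates a power of `g` to a nonzero power of `g`.
  let e : ℕ → G := fun b => g ^ (-(a + b)) * h * g ^ k b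
  have he : ∀ b ∈ Finset.range (s + 1), e b ∈ hN.toFinset := by
    intro b hb
    rw [Finset.mem_range] at hb
    rw [Set.Finite.mem_toFinset]
    refine ⟨?_, k (b + N) - k b, ?_⟩
    · have := hk b (by omega)
      simp only [e]
      rwa [mul_smul, mul_smul, zpow_neg, dist_inv_smul]
    · have := hk (b + N) (by omega)
      simp only [e]
      rw [smul_smul, mul_assoc, ← zpow_add, add_sub_cancel, mul_smul, mul_smul, zpow_neg,
        dist_inv_smul, smul_smul (g ^ (a + (b : ℤ))), ← zpow_natCast g N, ← zpow_add]
      push_cast at this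
      rwa [add_assoc]
  obtain ⟨b, hb, b', hb', hne, heq⟩ := Finset.exists_ne_map_eq_of_card_lt_of_maps_to
    (by rw [Finset.card_range]; omega) he
  have h1 : h * g ^ (k b - k b') * h⁻¹ = g ^ ((b : ℤ) - b') := by
    have h2 : g ^ (-(a + b)) * h * g ^ k b = g ^ (-(a + b')) * h * g ^ k b' := heq
    have h3 : h * g ^ k b = g ^ ((b : ℤ) - b') * (h * g ^ k b') := by
      have := congrArg (fun y => g ^ (a + b) * y) h2
      simp only [← mul_assoc, ← zpow_add, add_neg_cancel, zpow_zero, one_mul] at this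
      rw [this, ← mul_assoc]
      congr 3
      ring
    rw [zpow_sub, ← mul_assoc, h3]
    group
  have hbb : (b : ℤ) - b' ≠ 0 := by omega
  refine ⟨k b - k b', b - b', fun h0 => hbb (H.zpow_eq_one ?_), hbb, h1⟩
  rw [← h1, h0]
  simp

end CoarseAxis

/-- If everything commensurates `g`, then the group is virtually cyclic. -/
theorem CoarseAxis.isVirtuallyCyclic {G : Type*} [Group G] {X : Type*} [MetricSpace X]
    [MulAction G X] [IsIsometricSMul G X] {PS : Set (IntervalPath X)} {μ : ℝ} {g : G} {o : X}
    {φ : X → ℤ} {C : ℕ} (H : CoarseAxis PS μ g o φ C) (hg : ProperAlong g o)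
    (hall : ∀ h, Commensurates g h) : IsVirtuallyCyclic G := by
  obtain ⟨F, hF, hcov⟩ := H.finite_commensurates hg
  refine ⟨Subgroup.zpowers g, inferInstance, ?_⟩
  have : Finite F := hF
  have hsurj : Function.Surjective
      (fun e : F => (QuotientGroup.mk (e : G) : G ⧸ Subgroup.zpowers g)) := by
    intro x
    induction x using QuotientGroup.induction_on with
    | H h =>
      obtain ⟨e, he, k, rfl⟩ := hcov h (hall h)
      refine ⟨⟨e, he⟩, ?_⟩
      rw [QuotientGroup.eq]
      exact ⟨k, by simp⟩
  have := Finite.of_surjective _ hsurj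
  exact Subgroup.finiteIndex_of_finite_quotient

/-! ### From weak contraction to a coarse projection -/

/-- A weakly contracting element has a coarse projection to an orbit. -/
theorem IsWeaklyContracting.exists_coarseAxis {G : Type*} [Group G] {X : Type*} [MetricSpace X]
    [MulAction G X] [IsIsometricSMul G X] {PS : Set (IntervalPath X)} {g : G}
    (hPS : IsWeakPathSystem G PS) (hg : IsWeaklyContracting PS g) :
    ∃ (μ : ℝ) (o : X) (φ : X → ℤ) (C : ℕ), CoarseAxis PS μ g o φ C ∧ ProperAlong g o := by
  obtain ⟨μ, hμ, hq⟩ := hPS.isPathSystem.quasiGeodesic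
  obtain ⟨o, A, hoA, -, ⟨C, π, hπ, hπA, hcon⟩, B, -, hB, hcov⟩ := hg.axis
  obtain ⟨K, c, hK, hc, hqi⟩ := hg.wpd.quasiGeodesic o
  obtain ⟨R, hR⟩ := hB.subset_closedBall o
  have hproper : ∀ r : ℝ, ∃ J : ℕ, ∀ n : ℤ, dist (g ^ n • o) o ≤ r → |n| ≤ J := by
    intro r
    refine ⟨⌈K * (r + c)⌉₊, fun n hn => ?_⟩
    have h1 := (hqi n 0).1
    simp only [zpow_zero, one_smul, Int.dist_eq, Int.cast_zero, sub_zero] at h1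
    have h2 : |(n : ℝ)| / K ≤ r + c := by linarith
    rw [div_le_iff₀' (by linarith)] at h2
    exact_mod_cast h2.trans (Nat.le_ceil _)
  have hnear : ∀ x : X, ∃ n : ℤ, dist (π x) (g ^ n • o) ≤ R := by
    intro x
    obtain ⟨n, b, hb, h⟩ := hcov _ (hπ x)
    exact ⟨n, by rw [← h, dist_smul]; exact hR hb⟩
  choose φ hφ using hnear
  obtain ⟨J, hJ⟩ := hproper (2 * R + C)
  have hR0 : 0 ≤ R := dist_nonneg.trans (hφ o)
  have hsep : ∀ n m : ℤ, dist (g ^ n • o) (g ^ m • o) ≤ 2 * R + C → |n - m| ≤ J := fun n m h =>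
    hJ _ (by rwa [← dist_zpow_smul_zpow_smul])
  obtain ⟨C', hC'⟩ := exists_nat_ge (C + 1 + R)
  -- Exponents more than `J` apart force projections at distance at least `C`; `C'` absorbs the
  -- distance `R` from the projection to the orbit.
  refine ⟨μ, o, φ, max (J + 1) C', ⟨hPS, hμ, hq, fun n => ?_, fun δ hδ h => ?_, hproper⟩,
    fun R hR => hg.wpd.finite R hR o⟩
  · have h1 := hπA _ (hoA n)
    have h2 := hφ (g ^ n • o)
    have h3 := hsep (φ (g ^ n • o)) n (by
      have := dist_triangle (g ^ φ (g ^ n • o) • o) (π (g ^ n • o)) (g ^ n • o)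
      rw [dist_comm (g ^ φ (g ^ n • o) • o) (π _)] at this
      linarith)
    push_cast
    omega
  · have h1 : C ≤ dist (π δ.source) (π δ.target) := by
      by_contra hlt
      have h2 := hsep (φ δ.source) (φ δ.target) (by
        have := dist_triangle4 (g ^ φ δ.source • o) (π δ.source) (π δ.target)
          (g ^ φ δ.target • o)
        rw [dist_comm (g ^ φ δ.source • o) (π _)] at this
        linarith [hφ δ.source, hφ δ.target])
      push_cast at h
      omega
    obtain ⟨h2, h3⟩ := hcon _ _ h1 δ hδ rfl rfl
    have key : ∀ x, Metric.infDist (π x) δ.image ≤ C →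
        ∃ u ∈ Set.Icc δ.left δ.right, dist (δ.ev u) (g ^ φ x • o) ≤ (max (J + 1) C' : ℕ) := by
      intro x hx
      obtain ⟨p, hp, h4⟩ := (Metric.infDist_lt_iff ⟨_, δ.ev_mem_image δ.left⟩).1
        (hx.trans_lt (lt_add_one C))
      obtain ⟨u, hu, rfl⟩ := δ.exists_ev_eq hp
      refine ⟨u, hu, ?_⟩
      have h5 := dist_triangle (δ.ev u) (π x) (g ^ φ x • o)
      rw [dist_comm (δ.ev u) (π x)] at h5
      have h6 : (C' : ℝ) ≤ (max (J + 1) C' : ℕ) := by exact_mod_cast le_max_right _ _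
      linarith [hφ x]
    exact ⟨key _ h2, key _ h3⟩

/-! ### Translates of the axis arranged in a line -/

/-- The coordinate of `x` on the translate by `f ^ k` of an axis with coarse projection `φ`. -/
def coord {G : Type*} [Group G] {X : Type*} [MulAction G X] (φ : X → ℤ) (f : G) (x : X)
    (k : ℤ) : ℤ := φ ((f ^ k)⁻¹ • x)

theorem coord_zpow_smul {G : Type*} [Group G] {X : Type*} [MulAction G X] (φ : X → ℤ) (f : G)
    (x : X) (m k : ℤ) : coord φ f (f ^ m • x) k = coord φ f x (k - m) := by
  simp only [coord, smul_smul, ← zpow_neg, ← zpow_add]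
  congr 3
  ring

/-- The translates of an axis by the powers of `f` are arranged in a line: every point projects
to one of two antipodal places on one of any two consecutive translates. -/
structure Dichotomy {G : Type*} [Group G] {X : Type*} [MulAction G X] (φ : X → ℤ) (f : G)
    (o : X) (N B : ℕ) : Prop where
  lt : 2 * B < N
  dichotomy : ∀ x, |φ x| ≤ B ∨ |φ (f⁻¹ • x) + N| ≤ B
  base : |φ o| ≤ B
  base_inv : |φ (f⁻¹ • o) + N| ≤ B

namespace Dichotomy

variable {G : Type*} [Group G] {X : Type*} [MulAction G X] {φ : X → ℤ} {f : G} {o : X} {N B : ℕ}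

theorem step (D : Dichotomy φ f o N B) (x : X) (k : ℤ) :
    |coord φ f x k| ≤ B ∨ |coord φ f x (k + 1) + N| ≤ B := by
  have := D.dichotomy ((f ^ k)⁻¹ • x)
  rwa [smul_smul, ← mul_inv_rev, ← zpow_add_one] at this

/-- The places `0` and `-N` are disjoint because `2 * B < N`. Once the coordinate is not near `0`,
the next one is near `-N`, hence again not near `0`, and so on. -/
theorem far_of_lt (D : Dichotomy φ f o N B) {x : X} {k : ℤ} (hk : ¬ |coord φ f x k| ≤ B) {j : ℤ}
    (hj : k < j) : |coord φ f x j + N| ≤ B := by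
  induction j, (show k + 1 ≤ j from hj) using Int.leInduction with
  | base => exact (D.step x k).resolve_left hk
  | succ j hkj ih =>
    refine (D.step x j).resolve_left fun h => ?_
    have h1 := ih hkj
    have h2 := D.lt
    simp only [abs_le] at h h1
    omega

theorem near_of_le (D : Dichotomy φ f o N B) {x : X} {k : ℤ} (hk : |coord φ f x k| ≤ B) {j : ℤ}
    (hj : j ≤ k) : |coord φ f x j| ≤ B := by
  rcases hj.eq_or_lt with rfl | hj
  · exact hk
  by_contra hcon
  have h1 := D.far_of_lt hcon hj
  have h2 := D.lt
  simp only [abs_le] at hk h1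
  omega

theorem base_near (D : Dichotomy φ f o N B) {k : ℤ} (hk : k ≤ 0) : |coord φ f o k| ≤ B :=
  D.near_of_le (k := 0) (by simpa [coord] using D.base) hk

theorem base_far (D : Dichotomy φ f o N B) {k : ℤ} (hk : 1 ≤ k) : |coord φ f o k + N| ≤ B := by
  have h1 : |coord φ f o 1 + N| ≤ B := by simpa [coord] using D.base_inv
  rcases hk.eq_or_lt with rfl | hk
  · exact h1
  refine D.far_of_lt (k := 1) (fun h => ?_) hk
  have h2 := D.lt
  simp only [abs_le] at h h1
  omega

end Dichotomy

namespace CoarseAxis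

variable {G : Type*} [Group G] {X : Type*} [MetricSpace X] [MulAction G X] [IsIsometricSMul G X]
  {PS : Set (IntervalPath X)} {μ : ℝ} {g : G} {o : X} {φ : X → ℤ} {C : ℕ}

theorem near_coord (H : CoarseAxis PS μ g o φ C) (f : G) (k : ℤ) {δ : IntervalPath X}
    (hδ : δ ∈ PS) {s t : ℝ} (hs : δ.left ≤ s) (hst : s ≤ t) (ht : t ≤ δ.right)
    (h : (C : ℤ) ≤ |coord φ f (δ.ev s) k - coord φ f (δ.ev t) k|) :
    (∃ u ∈ Set.Icc s t, dist (δ.ev u) (f ^ k • g ^ coord φ f (δ.ev s) k • o) ≤ C) ∧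
    (∃ u ∈ Set.Icc s t, dist (δ.ev u) (f ^ k • g ^ coord φ f (δ.ev t) k • o) ≤ C) :=
  H.near_ev_translate (f ^ k) hδ hs hst ht h

/-- The Behrstock inequality for translates of the axis by noncommensurating elements. -/
theorem behrstock_of_not_commensurates (H : CoarseAxis PS μ g o φ C) (hg : ProperAlong g o) :
    ∃ B : ℕ, ∀ u : G, ¬ Commensurates g u →
      ∀ x : X, (∀ n : ℤ, |φ x - φ (u • g ^ n • o)| ≤ B) ∨
        (∀ n : ℤ, |φ (u⁻¹ • x) - φ (u⁻¹ • g ^ n • o)| ≤ B) := by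
  obtain ⟨B₀, hB₀⟩ := H.bounded_projection hg
  obtain ⟨B, hB⟩ := H.behrstock B₀
  exact ⟨B, fun u hu => hB u (hB₀ u hu) (hB₀ u⁻¹ fun h => hu (by simpa using h.inv))⟩

theorem exists_dichotomy (H : CoarseAxis PS μ g o φ C) (hg : ProperAlong g o) {h : G}
    (hh : ¬ Commensurates g h) :
    ∃ B : ℕ, ∀ N : ℕ, 2 * B < N → Dichotomy φ (h * g ^ N) o N B := by
  obtain ⟨B₀, hB₀⟩ := H.bounded_projection hg
  obtain ⟨B₁, hB₁⟩ := H.behrstock_of_not_commensurates hg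
  obtain ⟨E, hE⟩ := H.equivariant
  set b := (φ (h • g ^ (0 : ℤ) • o)).natAbs + (φ (h⁻¹ • g ^ (0 : ℤ) • o)).natAbs with hb
  have hh' : ¬ Commensurates g h⁻¹ := fun h1 => hh (by simpa using h1.inv)
  have hbd : ∀ n : ℤ, |φ (h • g ^ n • o)| ≤ b + B₀ := fun n => by
    have := hB₀ h hh n 0
    simp only [abs_le] at *
    omega
  have hbd' : ∀ n : ℤ, |φ (h⁻¹ • g ^ n • o)| ≤ b + B₀ := fun n => by
    have := hB₀ h⁻¹ hh' n 0
    simp only [abs_le] at *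
    omega
  have hinv : ∀ (N : ℕ) (n : ℤ), |φ ((h * g ^ N)⁻¹ • g ^ n • o) + N| ≤ b + B₀ + E := by
    intro N n
    have h1 := hE (-N) (h⁻¹ • g ^ n • o)
    rw [zpow_neg, zpow_natCast, smul_smul (g ^ N)⁻¹, ← mul_inv_rev] at h1
    have h2 := hbd' n
    simp only [abs_le] at *
    omega
  refine ⟨B₁ + b + B₀ + E + C, fun N hN => ⟨hN, fun x => ?_, ?_, ?_⟩⟩
  · have hf : ¬ Commensurates g (h * g ^ N) := fun h1 =>
      hh (by simpa [mul_assoc] using h1.mul_zpow (-N))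
    rcases hB₁ _ hf x with h1 | h1
    · left
      -- As `h * g ^ N * g ^ (-N) = h`, this point of the translate is `h • o`, whose projection is
      -- bounded independently of `N`.
      have h2 := h1 (-N)
      rw [mul_smul, ← zpow_natCast, smul_smul (g ^ (N : ℤ)), ← zpow_add, add_neg_cancel] at h2
      have h3 := hbd 0
      push_cast
      simp only [abs_le] at *
      omega
    · right
      have h2 := h1 0
      have h3 := hinv N 0
      push_cast
      simp only [abs_le] at *
      omega
  · have h1 := H.orbit 0
    rw [zpow_zero, one_smul] at h1
    push_cast
    simp only [abs_le] at *
    omega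
  · have h1 := hinv N 0
    rw [zpow_zero, one_smul] at h1
    push_cast
    simp only [abs_le] at *
    omega

/-- A path that crosses `n` consecutive translates of the axis has length at least `n`. -/
theorem length_ge (H : CoarseAxis PS μ g o φ C) (B : ℕ) : ∃ B' N₀ : ℕ, B ≤ B' ∧
    ∀ (f : G) (N : ℕ), N₀ ≤ N → Dichotomy φ f o N B → ∀ (n : ℕ), ∀ δ ∈ PS, ∀ s t : ℝ,
      δ.left ≤ s → s ≤ t → t ≤ δ.right →
      (∀ i : ℤ, 1 ≤ i → i ≤ n → |coord φ f (δ.ev s) i + N| ≤ B' ∧ |coord φ f (δ.ev t) i| ≤ B) →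
      (n : ℝ) ≤ t - s := by
  obtain ⟨J, hJ⟩ := H.bornologous (C + B * dist (g • o) o)
  obtain ⟨J', hJ'⟩ := H.bornologous (μ * 1 + μ)
  -- The tolerance `B + J` at the start does not grow in the induction: each new starting point is
  -- close to `f • o`, whose coordinates are known up to `B`.
  refine ⟨B + J, 2 * B + 2 * J + C + J' + 1, by omega, fun f N hN D n => ?_⟩
  induction n with
  | zero => intro δ _ s t _ hst _ _; simpa using hst
  | succ n ih =>
    intro δ hδ s t hs hst ht hi
    obtain ⟨h1, h2⟩ := hi 1 le_rfl (by push_cast; omega)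
    have hC : (C : ℤ) ≤ |coord φ f (δ.ev s) 1 - coord φ f (δ.ev t) 1| := by
      push_cast at h1
      rw [le_abs]
      simp only [abs_le] at *
      omega
    -- The path leaves the first translate near `f • o`. Reaching that point costs time at least
    -- `1`, because the first coordinate moves from `-N` to `0`; the rest, shifted by `f⁻¹`, crosses
    -- `n` translates.
    obtain ⟨-, u, hu, h3⟩ := H.near_coord f 1 hδ hs hst ht hC
    have h4 : dist (δ.ev u) (f • o) ≤ C + B * dist (g • o) o := by
      have h5 := dist_zpow_smul_le_of_abs_le g o (n := coord φ f (δ.ev t) 1) (m := 0)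
        (by simpa using h2)
      rw [zpow_zero, one_smul, Int.cast_natCast, ← dist_smul f] at h5
      rw [zpow_one] at h3
      linarith [dist_triangle (δ.ev u) (f • g ^ coord φ f (δ.ev t) 1 • o) (f • o)]
    have h5 : ∀ i : ℤ, |coord φ f (δ.ev u) i - coord φ f o (i - 1)| ≤ J := by
      intro i
      rw [← coord_zpow_smul, zpow_one]
      exact hJ _ _ (by rwa [dist_smul])
    have h6 : 1 ≤ u - s := by
      by_contra hlt
      have h7 := hJ' ((f ^ (1 : ℤ))⁻¹ • δ.ev s) ((f ^ (1 : ℤ))⁻¹ • δ.ev u) (by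
        rw [dist_smul]
        refine (IntervalPath.dist_ev_le (H.quasi δ hδ) ⟨hs, hst.trans ht⟩
          ⟨hs.trans hu.1, hu.2.trans ht⟩).trans ?_
        have : |s - u| ≤ 1 := by
          rw [abs_le]; constructor <;> linarith [hu.1]
        have := H.one_le
        gcongr)
      have h8 := h5 1
      have h9 := D.base_near (k := 1 - 1) (by norm_num)
      change |coord φ f (δ.ev s) 1 - coord φ f (δ.ev u) 1| ≤ J' at h7
      push_cast at h1
      simp only [abs_le] at *
      omega
    have h7 := ih (δ.translate f⁻¹) (H.weak.translate_mem _ _ hδ) u t (hs.trans hu.1) hu.2 ht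
      (fun i hi1 hi2 => by
        have e : ∀ r, coord φ f ((δ.translate f⁻¹).ev r) i = coord φ f (δ.ev r) (i + 1) := by
          intro r
          change coord φ f (f⁻¹ • δ.ev r) i = _
          rw [← zpow_neg_one, coord_zpow_smul, sub_neg_eq_add]
        rw [e, e]
        have h8 := h5 (i + 1)
        have h9 := D.base_far (k := i + 1 - 1) (by omega)
        refine ⟨?_, (hi (i + 1) (by omega) (by push_cast; omega)).2⟩
        push_cast
        simp only [abs_le] at *
        omega)
    push_cast
    linarith

/-- Points separated by `n` consecutive translates of the axis are at distance linear in `n`. -/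
theorem separation (H : CoarseAxis PS μ g o φ C) (B : ℕ) : ∃ N₀ : ℕ,
    ∀ (f : G) (N : ℕ), N₀ ≤ N → Dichotomy φ f o N B → ∀ (n : ℕ) (x y : X),
      (∀ i : ℤ, 1 ≤ i → i ≤ n → |coord φ f x i + N| ≤ B ∧ |coord φ f y i| ≤ B) →
      (n : ℝ) ≤ μ * (dist x y + μ) := by
  obtain ⟨B', N₀, hB', h⟩ := H.length_ge B
  refine ⟨N₀, fun f N hN D n x y hxy => ?_⟩
  obtain ⟨δ, hδ, rfl, rfl⟩ := H.exists_path x y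
  have h1 := h f N hN D n δ hδ δ.left δ.right le_rfl δ.le le_rfl (fun i hi hi' => by
    rw [δ.ev_left, δ.ev_right]
    have hb : (B : ℤ) ≤ B' := by exact_mod_cast hB'
    exact ⟨(hxy i hi hi').1.trans hb, (hxy i hi hi').2⟩)
  have h2 := IntervalPath.abs_sub_le H.one_le (H.quasi δ hδ) (s := δ.left) (t := δ.right)
    ⟨le_rfl, δ.le⟩ ⟨δ.le, le_rfl⟩
  rw [δ.ev_left, δ.ev_right, abs_sub_comm] at h2
  exact h1.trans ((le_abs_self _).trans h2)

end CoarseAxis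

/-! ### The coarse projection to the new axis -/

/-- `κ x` is the last translate of the axis that `x` is not beyond. -/
def IsGreatestNear {G : Type*} [Group G] {X : Type*} [MulAction G X] (φ : X → ℤ) (f : G)
    (B : ℕ) (κ : X → ℤ) : Prop :=
  ∀ x, |coord φ f x (κ x)| ≤ B ∧ ∀ k, |coord φ f x k| ≤ B → k ≤ κ x

namespace IsGreatestNear

variable {G : Type*} [Group G] {X : Type*} [MulAction G X] {φ : X → ℤ} {f : G} {o : X} {N B : ℕ}
  {κ : X → ℤ}

theorem near (hκ : IsGreatestNear φ f B κ) (D : Dichotomy φ f o N B) {x : X} {k : ℤ}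
    (hk : k ≤ κ x) : |coord φ f x k| ≤ B := D.near_of_le (hκ x).1 hk

theorem far (hκ : IsGreatestNear φ f B κ) (D : Dichotomy φ f o N B) {x : X} {k : ℤ}
    (hk : κ x + 2 ≤ k) : |coord φ f x k + N| ≤ B :=
  D.far_of_lt (k := κ x + 1) (fun h => by have := (hκ x).2 _ h; omega) (by omega)

theorem zpow_smul (hκ : IsGreatestNear φ f B κ) (m : ℤ) (x : X) : κ (f ^ m • x) = κ x + m := by
  apply le_antisymm
  · have h1 := (hκ (f ^ m • x)).1
    rw [coord_zpow_smul] at h1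
    have := (hκ x).2 _ h1
    omega
  · refine (hκ (f ^ m • x)).2 _ ?_
    rw [coord_zpow_smul, add_sub_cancel_right]
    exact (hκ x).1

theorem base (hκ : IsGreatestNear φ f B κ) (D : Dichotomy φ f o N B) : κ o = 0 := by
  apply le_antisymm
  · by_contra h
    have h1 := (hκ o).1
    have h2 := D.base_far (k := κ o) (by omega)
    have h3 := D.lt
    simp only [abs_le] at h1 h2
    omega
  · exact (hκ o).2 0 (D.base_near le_rfl)

/-- Only the translate just after `κ x`, where the switch takes place, leaves the coordinate
uncontrolled. -/
theorem abs_coord_le (hκ : IsGreatestNear φ f B κ) (D : Dichotomy φ f o N B) {x : X} {k : ℤ}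
    (hk : k ≠ κ x + 1) : |coord φ f x k| ≤ N + B := by
  rcases lt_or_gt_of_ne hk with hk | hk
  · have := hκ.near D (x := x) (k := k) (by omega)
    simp only [abs_le] at *
    omega
  · have := hκ.far D (x := x) (k := k) (by omega)
    simp only [abs_le] at *
    omega

end IsGreatestNear

namespace CoarseAxis

variable {G : Type*} [Group G] {X : Type*} [MetricSpace X] [MulAction G X] [IsIsometricSMul G X]
  {PS : Set (IntervalPath X)} {μ : ℝ} {g : G} {o : X} {φ : X → ℤ} {C : ℕ}

/-- The new axis: for `f` as in a dichotomy with large `N`, the orbit of `f` has a coarse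
projection. -/
theorem exists_axis (H : CoarseAxis PS μ g o φ C) (B : ℕ) : ∃ N₀ : ℕ,
    ∀ (f : G) (N : ℕ), N₀ ≤ N → Dichotomy φ f o N B →
      (∀ n : ℤ, |(n : ℝ)| ≤ μ * (dist (f ^ n • o) o + μ)) ∧
      ∃ (κ : X → ℤ) (C' : ℕ), CoarseAxis PS μ f o κ C' ∧ IsGreatestNear φ f B κ := by
  obtain ⟨N₀, hN₀⟩ := H.separation B
  refine ⟨N₀ + 2 * B + C, fun f N hN D => ?_⟩
  have hsep := hN₀ f N (by omega) D
  have hlin : ∀ n : ℤ, |(n : ℝ)| ≤ μ * (dist (f ^ n • o) o + μ) := by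
    have hpos : ∀ n : ℕ, (n : ℝ) ≤ μ * (dist (f ^ n • o) o + μ) := by
      intro n
      rw [dist_comm]
      refine hsep n o (f ^ n • o) fun i hi hi' => ⟨D.base_far hi, ?_⟩
      rw [← zpow_natCast, coord_zpow_smul]
      exact D.base_near (by omega)
    intro n
    obtain ⟨k, rfl | rfl⟩ := n.eq_nat_or_neg
    · simpa using hpos k
    · rw [zpow_neg, dist_inv_smul, dist_comm]
      simpa using hpos k
  have harch : ∀ x : X, ∃ n : ℕ, μ * (dist o x + μ) < n := fun x => exists_nat_gt _
  have hκ : ∀ x : X, ∃ k, |coord φ f x k| ≤ B ∧ ∀ j, |coord φ f x j| ≤ B → j ≤ k := by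
    intro x
    obtain ⟨n, hn⟩ := harch x
    -- Without an upper bound, or without any such index, arbitrarily many translates would separate
    -- `x` from `o`, against `separation`.
    apply Int.exists_greatest_of_bdd
    · by_contra hcon
      push Not at hcon
      refine absurd (hsep n o x fun i hi hi' => ⟨D.base_far hi, ?_⟩) (not_le.2 hn)
      obtain ⟨j, hj, hij⟩ := hcon i
      exact D.near_of_le hj hij.le
    · by_contra hcon
      push Not at hcon
      have h1 := hsep n (f ^ (n : ℤ) • x) (f ^ (n : ℤ) • o) fun i hi hi' => by
        rw [coord_zpow_smul, coord_zpow_smul]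
        exact ⟨D.far_of_lt (not_le.2 (hcon (i - n - 1))) (by omega), D.base_near (by omega)⟩
      rw [dist_smul, dist_comm] at h1
      linarith
  choose κ hκ using hκ
  have hκ : IsGreatestNear φ f B κ := hκ
  obtain ⟨C', hC'⟩ := exists_nat_ge ((C : ℝ) + ((N + B) * dist (g • o) o + 2 * dist (f • o) o))
  refine ⟨hlin, κ, max 2 C', ⟨H.weak, H.one_le, H.quasi, fun n => ?_, fun δ hδ hle => ?_,
    fun r => ?_⟩, hκ⟩
  · rw [hκ.zpow_smul, hκ.base D]
    simp
  · have close : ∀ (x p : X) (i : ℤ), i ≠ κ x + 1 → |i - κ x| ≤ 2 →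
        dist p (f ^ i • g ^ coord φ f x i • o) ≤ C →
        dist p (f ^ κ x • o) ≤ (max 2 C' : ℕ) := by
      intro x p i hi hi' hp
      have h1 := dist_zpow_smul_le_of_abs_le g o (n := coord φ f x i) (m := 0)
        (by simpa using hκ.abs_coord_le D hi)
      rw [zpow_zero, one_smul, ← dist_smul (f ^ i)] at h1
      have h2 := dist_zpow_smul_le_of_abs_le f o hi'
      push_cast at h1 h2
      have h3 : (C' : ℝ) ≤ (max 2 C' : ℕ) := by exact_mod_cast le_max_right _ _
      linarith [dist_triangle4 p (f ^ i • g ^ coord φ f x i • o) (f ^ i • o) (f ^ κ x • o)]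
    have hnear : ∀ i : ℤ, (C : ℤ) ≤ |coord φ f δ.source i - coord φ f δ.target i| →
        (∃ u ∈ Set.Icc δ.left δ.right,
          dist (δ.ev u) (f ^ i • g ^ coord φ f δ.source i • o) ≤ C) ∧
        (∃ u ∈ Set.Icc δ.left δ.right,
          dist (δ.ev u) (f ^ i • g ^ coord φ f δ.target i • o) ≤ C) := by
      intro i hi
      have := H.near_coord f i hδ le_rfl δ.le le_rfl (by rwa [δ.ev_left, δ.ev_right])
      rwa [δ.ev_left, δ.ev_right] at this
    have hbig : ∀ i : ℤ, (κ δ.source + 2 ≤ i ∧ i ≤ κ δ.target) ∨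
        (κ δ.target + 2 ≤ i ∧ i ≤ κ δ.source) →
        (C : ℤ) ≤ |coord φ f δ.source i - coord φ f δ.target i| := by
      rintro i (⟨h1, h2⟩ | ⟨h1, h2⟩)
      · have h3 := hκ.far D h1
        have h4 := hκ.near D h2
        rw [le_abs]
        simp only [abs_le] at h3 h4
        omega
      · have h3 := hκ.far D h1
        have h4 := hκ.near D h2
        rw [le_abs]
        simp only [abs_le] at h3 h4
        omega
    -- A gap of `2` is needed to step over the uncontrolled translate. The path then crosses a
    -- translate on which source and target have coordinates near opposite places, and so passes
    -- near both.
    have h2 : κ δ.source + 2 ≤ κ δ.target ∨ κ δ.target + 2 ≤ κ δ.source := by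
      push_cast at hle
      simp only [le_abs] at hle
      omega
    rcases h2 with h2 | h2
    · obtain ⟨u, hu, h3⟩ := (hnear (κ δ.source + 2) (hbig _ (by omega))).1
      obtain ⟨v, hv, h4⟩ := (hnear (κ δ.target) (hbig _ (by omega))).2
      exact ⟨⟨u, hu, close _ _ _ (by omega) (by simp) h3⟩,
        ⟨v, hv, close _ _ _ (by omega) (by simp) h4⟩⟩
    · obtain ⟨u, hu, h3⟩ := (hnear (κ δ.source) (hbig _ (by omega))).1
      obtain ⟨v, hv, h4⟩ := (hnear (κ δ.target + 2) (hbig _ (by omega))).2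
      exact ⟨⟨u, hu, close _ _ _ (by omega) (by simp) h3⟩,
        ⟨v, hv, close _ _ _ (by omega) (by simp) h4⟩⟩
  · refine ⟨⌈μ * (r + μ)⌉₊, fun n hn => ?_⟩
    have h1 : μ * (dist (f ^ n • o) o + μ) ≤ μ * (r + μ) := by
      have := H.one_le
      gcongr
    exact_mod_cast (hlin n).trans (h1.trans (Nat.le_ceil _))

end CoarseAxis

/-! ### The new element is WPD and weakly contracting -/

namespace CoarseAxis

variable {G : Type*} [Group G] {X : Type*} [MetricSpace X] [MulAction G X] [IsIsometricSMul G X]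
  {PS : Set (IntervalPath X)} {μ : ℝ} {g : G} {o : X} {φ : X → ℤ} {C : ℕ}

/-- If `k` nearly fixes `o` and a far away point of the new axis, then it maps some translate of the
old axis to one with unbounded projection. -/
theorem exists_commensurates (H : CoarseAxis PS μ g o φ C) (hg : ProperAlong g o) (h : G) (B : ℕ) :
    ∃ N₀ : ℕ, ∀ N : ℕ, N₀ ≤ N → Dichotomy φ (h * g ^ N) o N B →
      ∀ (i : ℤ) (M : ℕ) (k : G), |coord φ (h * g ^ N) (k • o) i + N| ≤ B →
        |coord φ (h * g ^ N) (k • (h * g ^ N) ^ M • o) i| ≤ B →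
        ∃ j ≤ M, Commensurates g (((h * g ^ N) ^ i)⁻¹ * k * (h * g ^ N) ^ j) := by
  obtain ⟨B₀, hB₀⟩ := H.bounded_projection hg
  obtain ⟨B₁, hB₁⟩ := H.behrstock_of_not_commensurates hg
  obtain ⟨J, hJ⟩ := H.bornologous (dist (h • o) o)
  refine ⟨2 * (B + B₀ + B₁ + J + 2), fun N hN D i M k h0 hM => ?_⟩
  set f := h * g ^ N with hf
  by_contra! hcon
  set a : ℕ → ℤ := fun j => φ (((f ^ i)⁻¹ * k * f ^ j) • o) with ha
  have ha0 : a 0 = coord φ f (k • o) i := by simp [ha, coord, mul_smul]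
  have haM : a M = coord φ f (k • f ^ M • o) i := by simp [ha, coord, mul_smul]
  rw [← ha0] at h0
  rw [← haM] at hM
  -- The points `k • f ^ j • h • o` and `k • f ^ (j + 1) • o` lie on one translate of the axis,
  -- which has bounded projection by noncommensuration; the first is within `dist (h • o) o` of `k •
  -- f ^ j • o`.
  have hjump : ∀ j < M, |a (j + 1) - a j| ≤ (B₀ + J : ℕ) := by
    intro j hj
    have h1 := hB₀ _ (hcon (j + 1) (by omega)) 0 (-N)
    have h2 : ((f ^ i)⁻¹ * k * f ^ (j + 1)) • g ^ (-(N : ℤ)) • o =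
        ((f ^ i)⁻¹ * k * f ^ j) • h • o := by
      simp only [smul_smul]
      congr 1
      rw [pow_succ, hf, zpow_neg, zpow_natCast]
      group
    have h3 := hJ (((f ^ i)⁻¹ * k * f ^ j) • h • o) (((f ^ i)⁻¹ * k * f ^ j) • o)
      (by rw [dist_smul])
    rw [h2, zpow_zero, one_smul] at h1
    push_cast
    simp only [ha, abs_le] at *
    omega
  -- Some orbit point projects to the middle, about `-N / 2`, far from the projections of both end
  -- points.
  obtain ⟨j, hj, hj1, hj2⟩ := exists_mem_Icc_of_bounded_jumps a M (B₀ + J) (-((N : ℤ) / 2))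
    (by simp only [abs_le] at h0; omega) (by simp only [abs_le] at hM; omega) hjump
  have hj0 : 1 ≤ j := by
    rcases Nat.eq_zero_or_pos j with rfl | h1
    · simp only [abs_le] at h0
      omega
    · exact h1
  -- By Behrstock, `f ^ l • o` then has the same coordinate on `f ^ j A` as the pulled-back
  -- translate. For `l = 0` that is near `-N` and for `l = M` near `0`, which is impossible.
  have key : ∀ l : ℕ, |a l - a j| > B₁ →
      ∀ n : ℤ, |coord φ f o (j - l) - φ (((f ^ i)⁻¹ * k * f ^ j)⁻¹ • g ^ n • o)| ≤ B₁ := by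
    intro l hl n
    rcases hB₁ _ (hcon j hj) (((f ^ i)⁻¹ * k * f ^ l) • o) with h1 | h1
    · have := h1 0
      rw [zpow_zero, one_smul] at this
      exact absurd this (not_le.2 hl)
    · have := h1 n
      have e : (((f ^ i)⁻¹ * k * f ^ j)⁻¹ • ((f ^ i)⁻¹ * k * f ^ l) • o) =
          (f ^ ((j : ℤ) - l))⁻¹ • o := by
        rw [smul_smul]
        congr 1
        rw [zpow_sub, zpow_natCast, zpow_natCast]
        group
      rwa [e] at this
  have h1 := key 0 (by
    rw [gt_iff_lt, lt_abs]
    simp only [abs_le] at h0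
    push_cast at hj2
    omega) 0
  have h2 := key M (by
    rw [gt_iff_lt, lt_abs]
    simp only [abs_le] at hM
    push_cast at hj2
    omega) 0
  have h3 := D.base_far (k := (j : ℤ) - (0 : ℕ)) (by push_cast; omega)
  have h4 := D.base_near (k := (j : ℤ) - M) (by omega)
  simp only [abs_le] at h1 h2 h3 h4
  omega

/-- Along the new axis the action is proper. -/
theorem exists_properAlong (H : CoarseAxis PS μ g o φ C) (hg : ProperAlong g o) (h : G) (B : ℕ) :
    ∃ N₀ : ℕ, ∀ N : ℕ, N₀ ≤ N → Dichotomy φ (h * g ^ N) o N B →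
      ∀ (κ : X → ℤ) (C' : ℕ), CoarseAxis PS μ (h * g ^ N) o κ C' →
        IsGreatestNear φ (h * g ^ N) B κ → ProperAlong (h * g ^ N) o := by
  obtain ⟨N₀, hN₀⟩ := H.exists_commensurates hg h B
  obtain ⟨F, hF, hcov⟩ := H.finite_commensurates hg
  refine ⟨N₀, fun N hN D κ C' Hκ hκ R hR => ?_⟩
  set f := h * g ^ N with hf
  obtain ⟨J, hJ⟩ := Hκ.bornologous R
  -- `κ (k • o) ≤ J` and `κ (k • f ^ M • o) ≥ M - J = J + 2`, so translate `J + 2` is far for the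
  -- first point and near for the second.
  set i : ℤ := J + 2 with hi
  set M : ℕ := 2 * J + 2 with hM
  have hfin : (⋃ e ∈ F, ⋃ j ∈ Set.Iic M,
      {k : G | dist o (k • o) ≤ R ∧ ∃ p : ℤ, k = f ^ i * (e * g ^ p) * (f ^ j)⁻¹}).Finite := by
    refine hF.biUnion fun e _ => (Set.finite_Iic M).biUnion fun j _ => ?_
    -- With `e` and `j` fixed, the bound on the displacement of `o` by `k` bounds the exponent `p`.
    obtain ⟨P, hP⟩ := H.proper (dist ((f ^ j)⁻¹ • o) o + R + dist (f ^ i • e • o) o)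
    refine ((Set.finite_Icc (-P : ℤ) P).image
      (fun p => f ^ i * (e * g ^ p) * (f ^ j)⁻¹)).subset ?_
    rintro k ⟨hk, p, rfl⟩
    refine ⟨p, ?_, rfl⟩
    rw [Set.mem_Icc, ← abs_le]
    apply hP
    have h1 : dist (f ^ i • e • g ^ p • (f ^ j)⁻¹ • o) (f ^ i • e • g ^ p • o) =
        dist ((f ^ j)⁻¹ • o) o := by simp only [dist_smul]
    have h2 : dist (f ^ i • e • g ^ p • o) (f ^ i • e • o) = dist (g ^ p • o) o := by
      simp only [dist_smul]
    simp only [mul_smul] at hk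
    rw [dist_comm] at h1
    have h3 := dist_triangle4 (f ^ i • e • g ^ p • o) (f ^ i • e • g ^ p • (f ^ j)⁻¹ • o) o
      (f ^ i • e • o)
    rw [dist_comm (f ^ i • e • g ^ p • (f ^ j)⁻¹ • o) o, dist_comm o (f ^ i • e • o)] at h3
    linarith
  refine ⟨M, hfin.subset ?_⟩
  rintro k ⟨hk1, hk2⟩
  have h1 := hJ _ _ hk1
  have h2 := hJ _ _ hk2
  rw [hκ.base D] at h1
  rw [← zpow_natCast f M, hκ.zpow_smul, hκ.base D] at h2
  obtain ⟨j, hj, hcomm⟩ := hN₀ N hN D i M k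
    (hκ.far D (by simp only [abs_le] at h1; omega))
    (hκ.near D (by rw [← hf, ← zpow_natCast f M]; simp only [abs_le] at h2; omega))
  obtain ⟨e, he, p, hp⟩ := hcov _ hcomm
  simp only [Set.mem_iUnion]
  refine ⟨e, he, j, hj, hk1, p, ?_⟩
  rw [← hp, ← hf]
  simp only [mul_assoc, mul_inv_cancel, mul_one, mul_inv_cancel_left]

/-- An element with a coarse projection to one of its quasi-geodesic orbits, along which the action
is proper, is weakly contracting. -/
theorem isWeaklyContracting (H : CoarseAxis PS μ g o φ C) (hg : ProperAlong g o)
    (hlin : ∀ n : ℤ, |(n : ℝ)| ≤ μ * (dist (g ^ n • o) o + μ)) : IsWeaklyContracting PS g := by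
  have hμ := H.one_le
  refine ⟨fun hfin => ?_, ⟨fun x => ?_, H.isMorse_orbit, fun R hR x => ?_⟩, o,
    Set.range fun n : ℤ => g ^ n • o, fun n => ⟨n, rfl⟩, ?_, H.isContracting_orbit,
    {o}, ?_, Bornology.isBounded_singleton, ?_⟩
  · obtain ⟨n, hn, h1⟩ := isOfFinOrder_iff_pow_eq_one.1 hfin
    have := H.zpow_eq_one (n := n) (by rwa [zpow_natCast])
    omega
  · have hd : 0 ≤ dist (g • x) x := dist_nonneg
    have hd' : 0 ≤ dist x o := dist_nonneg
    refine ⟨μ + dist (g • x) x, μ + 2 * dist x o, by linarith, by linarith, fun s t => ⟨?_, ?_⟩⟩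
    · have h1 := hlin (s - t)
      rw [← dist_zpow_smul_zpow_smul] at h1
      have h2 : |((s - t : ℤ) : ℝ)| = dist s t := by rw [Int.dist_eq]; push_cast; rfl
      rw [h2] at h1
      have h3 := dist_triangle4 (g ^ s • o) (g ^ s • x) (g ^ t • x) (g ^ t • o)
      rw [dist_smul, dist_smul, dist_comm o x] at h3
      have h4 : dist s t / (μ + dist (g • x) x) ≤ dist s t / μ := by
        gcongr
        linarith
      have h5 : dist s t / μ ≤ dist (g ^ s • o) (g ^ t • o) + μ := by
        rwa [div_le_iff₀' (by linarith)]
      linarith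
    · have h1 := dist_zpow_smul_le g x (s - t)
      rw [← dist_zpow_smul_zpow_smul] at h1
      have h2 : |((s - t : ℤ) : ℝ)| = dist s t := by rw [Int.dist_eq]; push_cast; rfl
      rw [h2] at h1
      have h3 : 0 ≤ μ * dist s t := by positivity
      rw [add_mul]
      linarith [mul_comm (dist s t) (dist (g • x) x)]
  · obtain ⟨N, hN⟩ := hg (R + 2 * dist x o) (by positivity)
    refine ⟨N, hN.subset ?_⟩
    rintro k ⟨h1, h2⟩
    constructor
    · have := dist_triangle4 o x (k • x) (k • o)
      rw [dist_smul, dist_comm o x] at this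
      linarith
    · have := dist_triangle4 (k • g ^ N • o) (k • g ^ N • x) (g ^ N • x) (g ^ N • o)
      rw [dist_smul, dist_smul, dist_smul, dist_comm o x] at this
      linarith
  · ext y
    rw [Set.mem_smul_set_iff_inv_smul_mem]
    constructor
    · rintro ⟨n, hn⟩
      refine ⟨n + 1, ?_⟩
      have : g ^ n • o = g⁻¹ • y := hn
      simp only [add_comm n 1, zpow_add, mul_smul, zpow_one, this, smul_inv_smul]
    · rintro ⟨n, rfl⟩
      refine ⟨-1 + n, ?_⟩
      simp only [zpow_add, mul_smul, zpow_neg_one]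
  · rw [Set.singleton_subset_iff]
    exact ⟨0, by simp⟩
  · rintro _ ⟨n, rfl⟩
    exact ⟨n, o, rfl, rfl⟩

end CoarseAxis

/-! ### Ping-pong -/

open scoped Function in
/-- The ping-pong lemma for two elements of a group in any universe. -/
theorem injective_lift_of_ping_pong {G : Type*} [Group G] (a : Fin 2 → G) {X : Type*}
    [MulAction G X] (P Q : Fin 2 → Set X) (hP : ∀ i, (P i).Nonempty)
    (hPP : Pairwise (Disjoint on P)) (hQQ : Pairwise (Disjoint on Q))
    (hPQ : ∀ i j, Disjoint (P i) (Q j)) (h : ∀ i, a i • (Q i)ᶜ ⊆ P i)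
    (h' : ∀ i, (a i)⁻¹ • (P i)ᶜ ⊆ Q i) : Function.Injective (FreeGroup.lift a) := by
  have h1 : Function.Injective (FreeGroup.lift (a ∘ ULift.down)) :=
    FreeGroup.injective_lift_of_ping_pong (a ∘ ULift.down) (P ∘ ULift.down) (Q ∘ ULift.down)
      (fun i => hP _) (hPP.comp_of_injective ULift.down_injective)
      (hQQ.comp_of_injective ULift.down_injective) (fun i j => hPQ _ _) (fun i => h _)
      (fun i => h' _)
  have h2 : FreeGroup.lift a =
      (FreeGroup.lift (a ∘ ULift.down)).comp (FreeGroup.map ULift.up) := by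
    ext i
    simp
  rw [h2, MonoidHom.coe_comp]
  exact h1.comp (FreeGroup.map_injective ULift.up_injective)

/-- Ping-pong for two elements that shift the integer coordinates `φ` and `κ`, if points with
large coordinate `κ` have small coordinate `φ`. -/
theorem generateFreely_of_coordinates {G : Type*} [Group G] {X : Type*} [MulAction G X]
    {φ κ : X → ℤ} {a b : G} (o : X) {T E m : ℕ}
    (ha : ∀ (n : ℤ) x, |φ (a ^ n • x) - φ x - n| ≤ E) (hb : ∀ (n : ℤ) x, κ (b ^ n • x) = κ x + n)
    (hκ : ∀ x, 1 ≤ κ x ∨ κ x ≤ -2 → |φ x| < T) (hm : 2 * T + E + 4 ≤ m) :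
    GenerateFreely (a ^ m) (b ^ m) := by
  have h1 : ∃ x, 1 ≤ κ x := ⟨b ^ (1 - κ o) • o, by rw [hb]; omega⟩
  have hT : 0 < (T : ℤ) := by
    obtain ⟨x, hx⟩ := h1
    exact (abs_nonneg _).trans_lt (hκ x (Or.inl hx))
  have hdisj : ∀ x, (T : ℤ) ≤ φ x ∨ φ x ≤ -T → ¬ 1 ≤ κ x ∧ ¬ κ x ≤ -2 := by
    intro x hx
    refine ⟨fun h => ?_, fun h => ?_⟩
    · have := hκ x (Or.inl h)
      rw [abs_lt] at this
      omega
    · have := hκ x (Or.inr h)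
      rw [abs_lt] at this
      omega
  have hshift : ∀ (x : X) (n : ℤ), φ x + n - E ≤ φ (a ^ n • x) ∧ φ (a ^ n • x) ≤ φ x + n + E := by
    intro x n
    have := ha n x
    rw [abs_le] at this
    omega
  -- The four regions are the two ends of each coordinate. The powers of `b` shift `κ` exactly,
  -- those of `a` shift `φ` up to `E`, so `m` must exceed the width of the gap plus this error.
  refine injective_lift_of_ping_pong ![a ^ m, b ^ m]
    ![{x | (T : ℤ) ≤ φ x}, {x | 1 ≤ κ x}] ![{x | φ x ≤ -T}, {x | κ x ≤ -2}] ?_ ?_ ?_ ?_ ?_ ?_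
  · rw [Fin.forall_fin_two]
    refine ⟨⟨a ^ (T + E - φ o) • o, ?_⟩, h1⟩
    have := (hshift o (T + E - φ o)).1
    change (T : ℤ) ≤ _
    omega
  · intro i j hij
    refine Set.disjoint_left.2 fun x => ?_
    fin_cases i <;> fin_cases j
    · exact absurd rfl hij
    · exact fun h h' => (hdisj x (Or.inl h)).1 h'
    · exact fun h h' => (hdisj x (Or.inl h')).1 h
    · exact absurd rfl hij
  · intro i j hij
    refine Set.disjoint_left.2 fun x => ?_
    fin_cases i <;> fin_cases j
    · exact absurd rfl hij
    · exact fun h h' => (hdisj x (Or.inr h)).2 h'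
    · exact fun h h' => (hdisj x (Or.inr h')).2 h
    · exact absurd rfl hij
  · intro i j
    refine Set.disjoint_left.2 fun x => ?_
    fin_cases i <;> fin_cases j
    · intro (h : (T : ℤ) ≤ φ x) (h' : φ x ≤ -T)
      omega
    · exact fun h h' => (hdisj x (Or.inl h)).2 h'
    · exact fun h h' => (hdisj x (Or.inr h')).1 h
    · intro (h : 1 ≤ κ x) (h' : κ x ≤ -2)
      omega
  · rw [Fin.forall_fin_two]
    constructor
    · rintro _ ⟨x, hx, rfl⟩
      have hx : ¬ φ x ≤ -T := hx
      change (T : ℤ) ≤ φ (a ^ m • x)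
      have := (hshift x m).1
      rw [zpow_natCast] at this
      omega
    · rintro _ ⟨x, hx, rfl⟩
      have hx : ¬ κ x ≤ -2 := hx
      change 1 ≤ κ (b ^ m • x)
      rw [← zpow_natCast, hb]
      omega
  · rw [Fin.forall_fin_two]
    constructor
    · rintro _ ⟨x, hx, rfl⟩
      have hx : ¬ (T : ℤ) ≤ φ x := hx
      change φ ((a ^ m)⁻¹ • x) ≤ -T
      have := (hshift x (-m)).2
      rw [zpow_neg, zpow_natCast] at this
      omega
    · rintro _ ⟨x, hx, rfl⟩
      have hx : ¬ 1 ≤ κ x := hx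
      change κ ((b ^ m)⁻¹ • x) ≤ -2
      rw [← zpow_natCast, ← zpow_neg, hb]
      omega

end WeakTits

/-! ### The theorem -/

theorem mainTheorem6 {G : Type*} [Group G] [Group.FG G] {X : Type*} [MetricSpace X]
    [MulAction G X] [IsIsometricSMul G X] (PS : Set (WeakTits.IntervalPath X))
    (hPS : WeakTits.IsWeakPathSystem G PS) (g : G)
    (hg : WeakTits.IsWeaklyContracting PS g) :
    WeakTits.IsVirtuallyCyclic G ∨
      ∃ (h : G) (N : ℕ), 0 < N ∧ WeakTits.IsWeaklyContracting PS (h * g ^ N) ∧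
        ∃ M : ℕ, ∀ m : ℕ, M ≤ m → WeakTits.GenerateFreely (g ^ m) ((h * g ^ N) ^ m) := by
  obtain ⟨μ, o, φ, C, H, hprop⟩ := hg.exists_coarseAxis hPS
  by_cases hall : ∀ h, WeakTits.Commensurates g h
  · exact Or.inl (H.isVirtuallyCyclic hprop hall)
  right
  push Not at hall
  obtain ⟨h, hh⟩ := hall
  obtain ⟨B, hB⟩ := H.exists_dichotomy hprop hh
  obtain ⟨N₁, hN₁⟩ := H.exists_axis B
  obtain ⟨N₂, hN₂⟩ := H.exists_properAlong hprop h B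
  obtain ⟨E, hE⟩ := H.equivariant
  set N := N₁ + N₂ + 2 * B + 1 with hN
  have D := hB N (by omega)
  obtain ⟨hlin, κ, C', Hκ, hκ⟩ := hN₁ (h * g ^ N) N (by omega) D
  refine ⟨h, N, by omega,
    Hκ.isWeaklyContracting (hN₂ N (by omega) D κ C' Hκ hκ) hlin, 2 * (N + B + 1) + E + 4,
    fun m hm => WeakTits.generateFreely_of_coordinates (κ := κ) o hE hκ.zpow_smul
      (fun x hx => ?_) hm⟩
  -- The coordinate on translate `0` is `φ` itself, and the excluded case is `κ x = -1`; hence the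
  -- regions `1 ≤ κ x` and `κ x ≤ -2`.
  have := hκ.abs_coord_le D (x := x) (k := 0) (by omega)
  rw [WeakTits.coord, zpow_zero, inv_one, one_smul] at this
  push_cast
  omega
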